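/- Let $n\ge 3$ be an integer, let $\alpha\in\mathbb R$, $\alpha\le 1$, and let $u\in C^4(\mathbb R^n)$ be a positive radial function satisfying $\Delta^2u=u^\alpha$ at every point of $\mathbb R^n$. Write also $u(r)$, $r\ge 0$, for the common value of $u$ on the sphere $|x|=r$, and $u''(0)$ for the second derivative of $r\mapsto u(r)$ at $r=0$ (one-sided, on $[0,\infty)$); write $u\sim f$ if $\lim_{r\to\infty}u(r)/f(r)=1$. Then: (a) If $\alpha=1$, then $$u\sim\big[u(0)+n\,u''(0)\big]\,\Gamma\big(\tfrac n2\big)\,2^{\frac{n-5}{2}}\,\pi^{-1/2}\,r^{-\frac{n-1}{2}}\,e^{r}.$$ (b) If $-1<\alpha<1$, then $$u\sim\Big[\Big(n+\tfrac{4\alpha}{1-\alpha}\Big)\Big(n+\tfrac{4\alpha}{1-\alpha}+2\Big)\Big(\tfrac{4\alpha}{1-\alpha}+2\Big)\Big(\tfrac{4\alpha}{1-\alpha}+4\Big)\Big]^{-\frac1{1-\alpha}}\,r^{\frac4{1-\alpha}}.$$ (c) If $\alpha=-1$, then $$u\sim\big(n(n-2)\big)^{-1/2}\,r^2(\ln r)^{1/2}.$$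 (d) If $\alpha<-1$, then $\int_0^\infty t\,u(t)^\alpha\,dt<\infty$ and $$u\sim\frac1{2n}\Big(\Delta u(0)+\frac1{n-2}\int_0^\infty t\,u(t)^\alpha\,dt\Big)\,r^2.$$ -/

import Mathlib

open Filter Topology MeasureTheory
open scoped Laplacian

/-- `U` is a positive entire classical solution of `Δ² U = U ^ α` on `ℝⁿ`. -/
def IsPositiveEntireSolution (n : ℕ) (α : ℝ) (U : EuclideanSpace ℝ (Fin n) → ℝ) : Prop :=
  ContDiff ℝ 4 U ∧ (∀ x, 0 < U x) ∧ ∀ x, Δ (Δ U) x = U x ^ α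

/-- `U` is radial, with profile `u` on `[0, ∞)`; the values of `u` on `(-∞, 0)` are irrelevant. -/
def IsRadialWithProfile {n : ℕ} (U : EuclideanSpace ℝ (Fin n) → ℝ) (u : ℝ → ℝ) : Prop :=
  ∀ x, U x = u ‖x‖

/-- The relation `u ∼ f` at infinity: `u r / f r → 1` as `r → ∞`. -/
def AsympAtInfty (u f : ℝ → ℝ) : Prop :=
  Tendsto (fun r : ℝ => u r / f r) atTop (𝓝 1)

/-!
For a radial solution `U` the profiles `f` of `U` and `g` of `Δ U` solve the system `Δ f = g`,
`Δ g = f ^ α`, written in divergence form: with `d = n - 1`, the flux `P = r ^ d * f'` satisfies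
`P' = r ^ d * g`, and the flux `Q = r ^ d * g'` satisfies `Q' = r ^ d * f ^ α`
(`IsPositiveRadialSystem`). The asymptotics are read off from these four first-order relations by
comparing derivatives and by L'Hospital's rule for denominators tending to infinity.

Since `Q ≥ 0`, `g` is nondecreasing. The point common to all cases is that `g` becomes positive
(`IsPositiveRadialSystem.exists_snd_pos`); then `f` is eventually increasing and grows at least
like `r ^ 2`.

* If `α = 1`, then `f + g` is a regular radial solution of `Δ s = s`, so a multiple of Poisson's
  integral, whose growth is given by Laplace's method; `f - g` solves `Δ D = -D` and is bounded.
* If `-1 < α < 1` and `p = 4 / (1 - α)`, then `f` lies between two positive multiples of `r ^ p`.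
  A bound `f ^ α ≤ K * r ^ (p - 4)` integrates to `f ≤ (K / A + ε) * r ^ p`, where
  `Δ² r ^ p = A * r ^ (p - 4)`, and similarly from below. This yields two inequalities between the
  lower and the upper limit of `f / r ^ p` which, `|α|` being less than one, force both limits to
  equal the fixed point `A ^ (-1 / (1 - α))` of `x ↦ x ^ α / A`.
* If `α = -1`, then `g` tends to infinity but varies slowly, as `r * g'` is bounded. So
  `f ∼ r ^ 2 * g / (2 * n)`, and the second equation becomes `(g ^ 2)' ∼ 4 * n / ((n - 2) * r)`.
* If `α < -1`, the source is integrable against `t`, and the primitive `(n - 2) * g + r * g'` of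
  `r * f ^ α` shows that `g` converges; then `f ∼ r ^ 2 * lim g / (2 * n)`.
-/

/-! ### The Laplacian of a radial function -/

theorem iteratedFDeriv_two_eq_iteratedDeriv_line {E : Type*} [NormedAddCommGroup E]
    [NormedSpace ℝ E] {W : E → ℝ} (hW : ContDiff ℝ 2 W) (x v : E) :
    iteratedFDeriv ℝ 2 W x ![v, v] = deriv (deriv fun t : ℝ => W (x + t • v)) 0 := by
  have hline : ∀ t : ℝ, HasDerivAt (fun t : ℝ => x + t • v) v t := fun t => by
    simpa using ((hasDerivAt_id t).smul_const v).const_add x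
  have h1 : (deriv fun t : ℝ => W (x + t • v)) = fun t => fderiv ℝ W (x + t • v) v := by
    funext t
    exact (((hW.differentiable (by norm_num)) _).hasFDerivAt.comp_hasDerivAt t (hline t)).deriv
  have h2 : DifferentiableAt ℝ (fderiv ℝ W) (x + (0 : ℝ) • v) :=
    ((hW.fderiv_right (m := 1) (by norm_num)).differentiable (by norm_num)) _
  have h3 : HasDerivAt (fun t : ℝ => fderiv ℝ W (x + t • v) v)
      (fderiv ℝ (fderiv ℝ W) (x + (0 : ℝ) • v) v v) 0 :=
    (ContinuousLinearMap.apply ℝ ℝ v).hasFDerivAt.comp_hasDerivAt (0 : ℝ)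
      (h2.hasFDerivAt.comp_hasDerivAt (0 : ℝ) (hline 0))
  rw [h1, iteratedFDeriv_two_apply, h3.deriv, zero_smul, add_zero]
  rfl

theorem ContDiff.laplacian_euclidean {n : ℕ} {W : EuclideanSpace ℝ (Fin n) → ℝ} {k : ℕ}
    (hW : ContDiff ℝ (k + 2) W) : ContDiff ℝ k (Δ W) := by
  rw [InnerProductSpace.laplacian_eq_iteratedFDeriv_orthonormalBasis W
    (EuclideanSpace.basisFun (Fin n) ℝ)]
  refine ContDiff.sum fun i _ => ?_
  have h := hW.iteratedFDeriv_right (m := k) (i := 2) (by norm_num)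
  exact ((ContinuousMultilinearMap.apply ℝ (fun _ : Fin 2 => EuclideanSpace ℝ (Fin n)) ℝ
    ![(EuclideanSpace.basisFun (Fin n) ℝ) i, (EuclideanSpace.basisFun (Fin n) ℝ) i]).contDiff).comp h

/-- A radial function has a radial Laplacian: two points of equal norm are exchanged by a
reflection, which leaves the function invariant and maps orthonormal bases to such. -/
theorem laplacian_eq_of_norm_eq {n : ℕ} {W : EuclideanSpace ℝ (Fin n) → ℝ} (hW : ContDiff ℝ 2 W)
    (hrad : ∀ x y, ‖x‖ = ‖y‖ → W x = W y) {x y : EuclideanSpace ℝ (Fin n)} (hxy : ‖x‖ = ‖y‖) :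
    Δ W x = Δ W y := by
  obtain ⟨L, hL⟩ : ∃ L : EuclideanSpace ℝ (Fin n) ≃ₗᵢ[ℝ] EuclideanSpace ℝ (Fin n), L x = y :=
    ⟨_, Submodule.reflection_sub hxy⟩
  have hWL : W ∘ (L.toContinuousLinearEquiv : _ →L[ℝ] _) = W := funext fun z => hrad _ _ (by simp)
  refine (congrFun (InnerProductSpace.laplacian_eq_iteratedFDeriv_orthonormalBasis W
    (EuclideanSpace.basisFun (Fin n) ℝ)) x).trans (Eq.trans ?_ (congrFun
      (InnerProductSpace.laplacian_eq_iteratedFDeriv_orthonormalBasis W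
        ((EuclideanSpace.basisFun (Fin n) ℝ).map L)) y).symm)
  refine Finset.sum_congr rfl fun i _ => ?_
  conv_lhs => rw [← hWL]
  rw [ContinuousLinearMap.iteratedFDeriv_comp_right _ hW _ (by norm_num)]
  simp only [ContinuousMultilinearMap.compContinuousLinearMap_apply]
  congr 1
  · congr 1
  · funext j
    fin_cases j <;> simp

/-- `f` is a solution, with flux `P = r ^ d * f'`, of the radial form
`(r ^ d * f')' = r ^ d * h` of the Poisson equation `Δ f = h` in dimension `d + 1`,
regular at the origin. The equations are imposed for `r > 0` only; continuity is required on all of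
`ℝ`, as `f` will be the restriction of a function on `ℝ ^ (d + 1)` to a full line. -/
structure IsRadialPotential (d : ℕ) (f P h : ℝ → ℝ) : Prop where
  continuous : Continuous f
  flux_continuous : Continuous P
  flux_zero : P 0 = 0
  hasDerivAt : ∀ r, 0 < r → HasDerivAt f (P r / r ^ d) r
  flux_hasDerivAt : ∀ r, 0 < r → HasDerivAt P (r ^ d * h r) r

section Radial

variable {d : ℕ} {W : EuclideanSpace ℝ (Fin (d + 1)) → ℝ}

theorem profile_norm (hrad : ∀ x y, ‖x‖ = ‖y‖ → W x = W y) (x : EuclideanSpace ℝ (Fin (d + 1))) :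
    W x = W (‖x‖ • EuclideanSpace.single 0 1) :=
  hrad _ _ (by simp [norm_smul])

theorem contDiff_profile {k : WithTop ℕ∞} (hW : ContDiff ℝ k W) :
    ContDiff ℝ k fun r : ℝ => W (r • EuclideanSpace.single 0 1) :=
  hW.comp (contDiff_id.smul contDiff_const)

/-- The second derivative at a point `r • e` in a direction tangent to the sphere is `w' / r`,
where `w` is the profile. -/
theorem deriv_deriv_tangential (hW : ContDiff ℝ 2 W) (hrad : ∀ x y, ‖x‖ = ‖y‖ → W x = W y)
    {r : ℝ} (hr : 0 < r) {i : Fin (d + 1)} (hi : i ≠ 0) :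
    deriv (deriv fun t : ℝ => W (r • EuclideanSpace.single 0 1 + t • EuclideanSpace.single i 1)) 0
      = deriv (fun r : ℝ => W (r • EuclideanSpace.single 0 1)) r / r := by
  set w : ℝ → ℝ := fun r => W (r • EuclideanSpace.single 0 1) with hw
  have hwd : ContDiff ℝ 2 w := contDiff_profile hW
  have hnorm : ∀ t : ℝ, ‖r • EuclideanSpace.single (0 : Fin (d + 1)) (1 : ℝ)
      + t • EuclideanSpace.single i (1 : ℝ)‖ = √(r ^ 2 + t ^ 2) := by
    intro t
    have horth : inner ℝ (r • EuclideanSpace.single (0 : Fin (d + 1)) (1 : ℝ))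
        (t • EuclideanSpace.single i (1 : ℝ)) = 0 := by
      simp [inner_smul_left, inner_smul_right, EuclideanSpace.inner_single_left, hi.symm]
    have h := norm_add_sq_eq_norm_sq_add_norm_sq_of_inner_eq_zero _ _ horth
    rw [eq_comm, Real.sqrt_eq_iff_mul_self_eq (by positivity) (norm_nonneg _), h]
    simp [norm_smul]; ring
  have hfun : (fun t : ℝ => W (r • EuclideanSpace.single 0 1 + t • EuclideanSpace.single i 1))
      = fun t => w (√(r ^ 2 + t ^ 2)) := by
    funext t
    rw [profile_norm hrad, hnorm]
  have hpos : ∀ t : ℝ, 0 < r ^ 2 + t ^ 2 := fun t => by positivity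
  have hsq : ∀ t : ℝ, HasDerivAt (fun t : ℝ => √(r ^ 2 + t ^ 2)) (t / √(r ^ 2 + t ^ 2)) t := by
    intro t
    have := ((hasDerivAt_pow 2 t).const_add (r ^ 2)).sqrt (hpos t).ne'
    convert this using 1
    have := (Real.sqrt_pos.2 (hpos t)).ne'
    simp; field_simp
  have h1 : (deriv fun t : ℝ => w (√(r ^ 2 + t ^ 2)))
      = fun t => (deriv w (√(r ^ 2 + t ^ 2)) / √(r ^ 2 + t ^ 2)) * t := by
    funext t
    have := (((hwd.differentiable (by norm_num)) _).hasDerivAt.comp t (hsq t)).deriv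
    simp only [Function.comp_def] at this
    rw [this]; ring
  rw [hfun, h1]
  have hd1 : DifferentiableAt ℝ (deriv w) (√(r ^ 2 + 0 ^ 2)) := by
    have : ContDiff ℝ 1 (deriv w) := 
      (contDiff_succ_iff_deriv.1
        (by simpa [one_add_one_eq_two] using hwd : ContDiff ℝ (1 + 1) w)).2.2
    exact (this.differentiable (by norm_num)) _
  have h2 : DifferentiableAt ℝ (fun t : ℝ => deriv w (√(r ^ 2 + t ^ 2)) / √(r ^ 2 + t ^ 2)) 0 :=
    (hd1.comp (0 : ℝ) (hsq 0).differentiableAt).div (hsq 0).differentiableAt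
      (Real.sqrt_pos.2 (hpos 0)).ne'
  have h3 := (h2.hasDerivAt.mul (hasDerivAt_id (0 : ℝ))).deriv
  simp only [Pi.mul_def, id] at h3
  rw [h3]
  simp [Real.sqrt_sq hr.le]

theorem laplacian_eq_sum_deriv_deriv (hW : ContDiff ℝ 2 W) (x : EuclideanSpace ℝ (Fin (d + 1))) :
    Δ W x = ∑ i, deriv (deriv fun t : ℝ => W (x + t • EuclideanSpace.single i 1)) 0 := by
  rw [InnerProductSpace.laplacian_eq_iteratedFDeriv_orthonormalBasis W
    (EuclideanSpace.basisFun (Fin (d + 1)) ℝ)]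
  exact Finset.sum_congr rfl fun i _ => by
    simpa using iteratedFDeriv_two_eq_iteratedDeriv_line hW x (EuclideanSpace.single i 1)

/-- The Laplacian of a radial function in polar coordinates. -/
theorem laplacian_radial (hW : ContDiff ℝ 2 W) (hrad : ∀ x y, ‖x‖ = ‖y‖ → W x = W y)
    {r : ℝ} (hr : 0 < r) :
    Δ W (r • EuclideanSpace.single 0 1)
      = deriv (deriv fun r : ℝ => W (r • EuclideanSpace.single 0 1)) r
        + d * (deriv (fun r : ℝ => W (r • EuclideanSpace.single 0 1)) r / r) := by
  rw [laplacian_eq_sum_deriv_deriv hW, Fin.sum_univ_succ]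
  congr 1
  · simp only [← add_smul]
    have h1 : (deriv fun t : ℝ => W ((r + t) • EuclideanSpace.single 0 1))
        = fun t => deriv (fun r : ℝ => W (r • EuclideanSpace.single 0 1)) (r + t) := by
      funext t
      exact deriv_comp_const_add (fun r : ℝ => W (r • EuclideanSpace.single 0 1)) r t
    rw [h1, deriv_comp_const_add, add_zero]
  · rw [Finset.sum_congr rfl fun i _ => deriv_deriv_tangential hW hrad hr (Fin.succ_ne_zero i)]
    simp

theorem laplacian_radial_zero (hW : ContDiff ℝ 2 W) (hrad : ∀ x y, ‖x‖ = ‖y‖ → W x = W y) :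
    Δ W 0 = (d + 1) * deriv (deriv fun r : ℝ => W (r • EuclideanSpace.single 0 1)) 0 := by
  rw [laplacian_eq_sum_deriv_deriv hW]
  have : ∀ i : Fin (d + 1), (fun t : ℝ => W (0 + t • EuclideanSpace.single i 1))
      = fun r : ℝ => W (r • EuclideanSpace.single 0 1) := fun i => funext fun t =>
    hrad _ _ (by simp [norm_smul])
  rw [Finset.sum_congr rfl fun i _ => by rw [this i]]
  simp

/-- The restriction of a radial function to the line spanned by `EuclideanSpace.single 0 1` is a
potential of the restriction of its Laplacian. -/
theorem isRadialPotential_profile (hd : d ≠ 0) (hW : ContDiff ℝ 2 W)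
    (hrad : ∀ x y, ‖x‖ = ‖y‖ → W x = W y) :
    IsRadialPotential d (fun r => W (r • EuclideanSpace.single 0 1))
      (fun r => r ^ d * deriv (fun r : ℝ => W (r • EuclideanSpace.single 0 1)) r)
      (fun r => Δ W (r • EuclideanSpace.single 0 1)) := by
  have hwd := contDiff_profile hW
  have hw1 : ContDiff ℝ 1 (deriv fun r : ℝ => W (r • EuclideanSpace.single 0 1)) :=
    (contDiff_succ_iff_deriv.1 (by simpa [one_add_one_eq_two] using hwd :
      ContDiff ℝ (1 + 1) fun r : ℝ => W (r • EuclideanSpace.single 0 1))).2.2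
  refine ⟨hwd.continuous, (continuous_pow d).mul hw1.continuous, by simp [hd], ?_, ?_⟩
  · intro r hr
    rw [mul_div_cancel_left₀ _ (by positivity)]
    exact ((hwd.differentiable (by norm_num)) r).hasDerivAt
  · intro r hr
    refine ((hasDerivAt_pow d r).mul
      ((hw1.differentiable (by norm_num)) r).hasDerivAt).congr_deriv ?_
    rw [laplacian_radial hW hrad hr]
    obtain ⟨k, rfl⟩ := Nat.exists_eq_succ_of_ne_zero hd
    simp [pow_succ]; field_simp; ring

end Radial

/-! ### Comparison of derivatives -/

theorem sub_le_sub_of_deriv_le {a b a' b' : ℝ → ℝ} {x y : ℝ} (hxy : x ≤ y)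
    (hac : ContinuousOn a (Set.Icc x y)) (hbc : ContinuousOn b (Set.Icc x y))
    (ha : ∀ t ∈ Set.Ioo x y, HasDerivAt a (a' t) t) (hb : ∀ t ∈ Set.Ioo x y, HasDerivAt b (b' t) t)
    (h : ∀ t ∈ Set.Ioo x y, a' t ≤ b' t) : a y - a x ≤ b y - b x := by
  have hmono : MonotoneOn (b - a) (Set.Icc x y) := by
    refine monotoneOn_of_deriv_nonneg (convex_Icc x y) (hbc.sub hac) ?_ ?_
    · rw [interior_Icc]
      exact fun t ht => ((hb t ht).sub (ha t ht)).differentiableAt.differentiableWithinAt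
    · rw [interior_Icc]
      intro t ht
      rw [((hb t ht).sub (ha t ht)).deriv]
      exact sub_nonneg.2 (h t ht)
  have := hmono (Set.left_mem_Icc.2 hxy) (Set.right_mem_Icc.2 hxy) hxy
  simp only [Pi.sub_apply] at this
  linarith

/-- An inequality between derivatives integrates, with any loss in the constant absorbing the
constant of integration when the majorant tends to infinity. -/
theorem eventually_le_mul_of_deriv_le {a b a' b' : ℝ → ℝ} {K K' : ℝ} (hK : K < K')
    (ha : ∀ᶠ r in atTop, HasDerivAt a (a' r) r) (hb : ∀ᶠ r in atTop, HasDerivAt b (b' r) r)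
    (h : ∀ᶠ r in atTop, a' r ≤ K * b' r) (hbt : Tendsto b atTop atTop) :
    ∀ᶠ r in atTop, a r ≤ K' * b r := by
  obtain ⟨R, hR⟩ := eventually_atTop.1 (ha.and (hb.and h))
  filter_upwards [hbt.eventually_ge_atTop ((a R - K * b R) / (K' - K)), eventually_ge_atTop R]
    with r hr hRr
  have h1 := sub_le_sub_of_deriv_le (b := fun r => K * b r) hRr
    (fun t ht => (hR t ht.1).1.continuousAt.continuousWithinAt)
    (fun t ht => ((hR t ht.1).2.1.const_mul K).continuousAt.continuousWithinAt)
    (fun t ht => (hR t ht.1.le).1) (fun t ht => (hR t ht.1.le).2.1.const_mul K)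
    (fun t ht => (hR t ht.1.le).2.2)
  rw [div_le_iff₀ (sub_pos.2 hK)] at hr
  linarith

/-- L'Hospital's rule at infinity for quotients whose denominator tends to infinity. -/
theorem tendsto_div_of_tendsto_deriv_div {a b a' b' : ℝ → ℝ} {L : ℝ}
    (ha : ∀ᶠ r in atTop, HasDerivAt a (a' r) r) (hb : ∀ᶠ r in atTop, HasDerivAt b (b' r) r)
    (hpos : ∀ᶠ r in atTop, 0 < b' r) (hbt : Tendsto b atTop atTop)
    (h : Tendsto (fun r => a' r / b' r) atTop (𝓝 L)) :
    Tendsto (fun r => a r / b r) atTop (𝓝 L) := by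
  refine tendsto_order.2 ⟨fun l hl => ?_, fun l hl => ?_⟩
  · obtain ⟨m, hlm, hmL⟩ := exists_between hl
    obtain ⟨k, hlk, hkm⟩ := exists_between hlm
    have h1 := eventually_le_mul_of_deriv_le (a := -a) (a' := -a') (K := -m) (K' := -k)
      (by linarith) (ha.mono fun r hr => hr.neg) hb (by
        filter_upwards [(tendsto_order.1 h).1 m hmL, hpos] with r hr hp
        rw [lt_div_iff₀ hp] at hr
        simp only [Pi.neg_apply]
        linarith) hbt
    filter_upwards [h1, hbt.eventually_gt_atTop 0] with r hr hp
    rw [lt_div_iff₀ hp]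
    simp only [Pi.neg_apply] at hr
    have := mul_lt_mul_of_pos_right hlk hp
    linarith
  · obtain ⟨m, hLm, hml⟩ := exists_between hl
    obtain ⟨k, hmk, hkl⟩ := exists_between hml
    have h1 := eventually_le_mul_of_deriv_le hmk ha hb (by
        filter_upwards [(tendsto_order.1 h).2 m hLm, hpos] with r hr hp
        rw [div_lt_iff₀ hp] at hr
        linarith) hbt
    filter_upwards [h1, hbt.eventually_gt_atTop 0] with r hr hp
    rw [div_lt_iff₀ hp]
    have := mul_lt_mul_of_pos_right hkl hp
    linarith

/-! ### Radial potentials -/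

namespace IsRadialPotential

variable {d : ℕ} {f P h : ℝ → ℝ}

theorem neg (H : IsRadialPotential d f P h) : IsRadialPotential d (-f) (-P) (-h) where
  continuous := H.continuous.neg
  flux_continuous := H.flux_continuous.neg
  flux_zero := by simp [H.flux_zero]
  hasDerivAt r hr := (H.hasDerivAt r hr).neg.congr_deriv (by simp [neg_div])
  flux_hasDerivAt r hr := (H.flux_hasDerivAt r hr).neg.congr_deriv (by simp)

theorem flux_nonneg (H : IsRadialPotential d f P h) (hh : ∀ r, 0 < r → 0 ≤ h r) {r : ℝ}
    (hr : 0 ≤ r) : 0 ≤ P r := by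
  have := sub_le_sub_of_deriv_le (a := fun _ => (0 : ℝ)) (a' := fun _ => 0) hr continuousOn_const
    H.flux_continuous.continuousOn (fun t _ => hasDerivAt_const t 0)
    (fun t ht => H.flux_hasDerivAt t ht.1)
    (fun t ht => mul_nonneg (pow_nonneg ht.1.le d) (hh t ht.1))
  rw [H.flux_zero] at this
  linarith

theorem monotoneOn (H : IsRadialPotential d f P h) {R : ℝ} (hR : 0 ≤ R)
    (hP : ∀ r, R < r → 0 ≤ P r) : MonotoneOn f (Set.Ici R) := by
  intro x hx y _ hxy
  have hx' : R ≤ x := hx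
  have := sub_le_sub_of_deriv_le (a := fun _ => (0 : ℝ)) (a' := fun _ => 0) hxy continuousOn_const
    H.continuous.continuousOn (fun t _ => hasDerivAt_const t 0)
    (fun t ht => H.hasDerivAt t (by linarith [ht.1]))
    (fun t ht => div_nonneg (hP t (by linarith [ht.1]))
      (pow_nonneg (by linarith [ht.1] : (0 : ℝ) ≤ t) d))
  linarith

/-- The growth of a potential over `[2 * R, 4 * R]` forced by a lower bound of the source. -/
theorem le_sub_of_le_source (H : IsRadialPotential d f P h) {R K : ℝ} (hR : 0 < R) (hK : 0 ≤ K)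
    (hP : 0 ≤ P R) (hh : ∀ r ∈ Set.Icc R (4 * R), K ≤ h r) :
    3 * K * R ^ 2 / (d + 1) ≤ f (4 * R) - f (2 * R) := by
  have hd : (0 : ℝ) < d + 1 := by positivity
  have hflux : ∀ r ∈ Set.Icc (2 * R) (4 * R), K * r ^ (d + 1) / (2 * (d + 1)) ≤ P r := by
    intro r hr
    have h1 := sub_le_sub_of_deriv_le (x := R) (y := r) (a := fun t => K / (d + 1) * t ^ (d + 1))
      (a' := fun t => K * t ^ d) (by linarith [hr.1])
      (by fun_prop) H.flux_continuous.continuousOn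
      (fun t _ => ((hasDerivAt_pow (d + 1) t).const_mul (K / (d + 1))).congr_deriv (by
        push_cast; field_simp))
      (fun t ht => H.flux_hasDerivAt t (by linarith [ht.1]))
      (fun t ht => by
        rw [mul_comm]
        exact mul_le_mul_of_nonneg_left (hh t ⟨ht.1.le, by linarith [ht.2, hr.2]⟩)
          (pow_nonneg (by linarith [ht.1] : (0 : ℝ) ≤ t) d))
    have h2 : R ^ (d + 1) ≤ r ^ (d + 1) / 2 := by
      calc R ^ (d + 1) ≤ (r / 2) ^ (d + 1) := by gcongr; linarith [hr.1]
        _ = r ^ (d + 1) / 2 ^ (d + 1) := div_pow _ _ _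
        _ ≤ r ^ (d + 1) / 2 := by
          have : 0 ≤ r := by linarith [hr.1]
          gcongr
          exact le_self_pow₀ (by norm_num) (by omega)
    have h3 : K / (d + 1) * R ^ (d + 1) ≤ K / (d + 1) * (r ^ (d + 1) / 2) := by gcongr
    have h4 : K * r ^ (d + 1) / (2 * (d + 1)) = K / (d + 1) * (r ^ (d + 1) / 2) := by
      field_simp
    have h5 : K / (d + 1) * r ^ (d + 1) = 2 * (K / (d + 1) * (r ^ (d + 1) / 2)) := by ring
    linarith
  have h6 := sub_le_sub_of_deriv_le (x := 2 * R) (y := 4 * R)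
    (a := fun t => K / (4 * (d + 1)) * t ^ 2) (a' := fun t => K / (2 * (d + 1)) * t) (by linarith)
    (by fun_prop) H.continuous.continuousOn
    (fun t _ => ((hasDerivAt_pow 2 t).const_mul (K / (4 * (d + 1)))).congr_deriv (by
      push_cast; field_simp; norm_num))
    (fun t ht => H.hasDerivAt t (by linarith [ht.1]))
    (fun t ht => by
      have htp : 0 < t := by linarith [ht.1]
      rw [le_div_iff₀ (by positivity)]
      refine le_trans (le_of_eq ?_) (hflux t ⟨ht.1.le, ht.2.le⟩)
      field_simp; ring)
  refine le_trans (le_of_eq ?_) h6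
  field_simp; ring

/-- `(d - 1) * f + r * f'` is a primitive of `r * h`, in dimension `d + 1`. -/
theorem hasDerivAt_mul_add_flux {k : ℕ} (H : IsRadialPotential (k + 1) f P h) {r : ℝ} (hr : 0 < r) :
    HasDerivAt (fun r => k * f r + P r / r ^ k) (r * h r) r := by
  refine (((H.hasDerivAt r hr).const_mul (k : ℝ)).add
    ((H.flux_hasDerivAt r hr).div (hasDerivAt_pow k r) (by positivity))).congr_deriv ?_
  rcases k with _ | k
  · simp
  · simp only [Nat.add_sub_cancel]
    field_simp
    ring

theorem hasDerivAt_pow_mul {k : ℕ} (H : IsRadialPotential (k + 2) f P h) {r : ℝ} (hr : 0 < r) :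
    HasDerivAt (fun r => r ^ (k + 1) * f r)
      (r ^ k * (((k + 1 : ℕ) : ℝ) * f r + P r / r ^ (k + 1))) r := by
  refine ((hasDerivAt_pow (k + 1) r).mul (H.hasDerivAt r hr)).congr_deriv ?_
  simp only [Nat.add_sub_cancel]
  field_simp
  ring

/-- A source bounded by `K * r ^ (q - 2)` produces a potential bounded by any multiple of `r ^ q`
larger than the exact solution `K / (q * (q + d - 1)) * r ^ q`. -/
theorem eventually_le_rpow (H : IsRadialPotential d f P h) {q K K' : ℝ} (hq : 0 < q)
    (hqd : 0 < q + d - 1) (hh : ∀ᶠ r in atTop, h r ≤ K * r ^ (q - 2))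
    (hK : K / (q * (q + d - 1)) < K') : ∀ᶠ r in atTop, f r ≤ K' * r ^ q := by
  obtain ⟨L, hL1, hL2⟩ : ∃ L, K / (q + d - 1) < L ∧ L < K' * q := exists_between (by
    rw [div_lt_iff₀ (by positivity)] at hK ⊢
    linarith)
  have hP : ∀ᶠ r in atTop, P r ≤ L * r ^ (q + d - 1) := by
    refine eventually_le_mul_of_deriv_le hL1 (a' := fun r => r ^ d * h r)
      (b' := fun r => (q + d - 1) * r ^ (q + d - 1 - 1)) ?_ ?_ ?_ (tendsto_rpow_atTop hqd)
    · filter_upwards [eventually_gt_atTop 0] with r hr using H.flux_hasDerivAt r hr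
    · filter_upwards [eventually_gt_atTop 0] with r hr
      exact Real.hasDerivAt_rpow_const (Or.inl hr.ne')
    · filter_upwards [hh, eventually_gt_atTop 0] with r hr hr0
      have : r ^ (q + d - 1 - 1) = r ^ d * r ^ (q - 2) := by
        rw [← Real.rpow_natCast r d, ← Real.rpow_add hr0]; congr 1; ring
      rw [this, div_mul_eq_mul_div, mul_div_assoc, mul_div_cancel_left₀ _ hqd.ne', mul_left_comm]
      gcongr
  refine eventually_le_mul_of_deriv_le (K := L / q) (by rwa [div_lt_iff₀ hq])
    (a' := fun r => P r / r ^ d) (b' := fun r => q * r ^ (q - 1)) ?_ ?_ ?_ (tendsto_rpow_atTop hq)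
  · filter_upwards [eventually_gt_atTop 0] with r hr using H.hasDerivAt r hr
  · filter_upwards [eventually_gt_atTop 0] with r hr
    exact Real.hasDerivAt_rpow_const (Or.inl hr.ne')
  · filter_upwards [hP, eventually_gt_atTop 0] with r hr hr0
    have : r ^ (q + d - 1) = r ^ d * r ^ (q - 1) := by
      rw [← Real.rpow_natCast r d, ← Real.rpow_add hr0]; congr 1; ring
    rw [this] at hr
    rw [div_mul_eq_mul_div, mul_div_assoc, mul_div_cancel_left₀ _ hq.ne',
      div_le_iff₀ (by positivity)]
    linarith

theorem eventually_rpow_le (H : IsRadialPotential d f P h) {q K K' : ℝ} (hq : 0 < q)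
    (hqd : 0 < q + d - 1) (hh : ∀ᶠ r in atTop, K * r ^ (q - 2) ≤ h r)
    (hK : K' < K / (q * (q + d - 1))) : ∀ᶠ r in atTop, K' * r ^ q ≤ f r := by
  have := H.neg.eventually_le_rpow (K := -K) (K' := -K') hq hqd
    (hh.mono fun r hr => by simp only [Pi.neg_apply]; linarith) (by rw [neg_div]; linarith)
  exact this.mono fun r hr => by simp only [Pi.neg_apply] at hr; linarith

end IsRadialPotential

/-! ### Positivity of the Laplacian and growth -/

/-- The radial system `Δ f = g`, `Δ g = f ^ α` in dimension `d + 1` with `f` positive; `P` and `Q`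
are the fluxes of `f` and `g`. -/
structure IsPositiveRadialSystem (d : ℕ) (α : ℝ) (f P g Q : ℝ → ℝ) : Prop where
  fst : IsRadialPotential d f P g
  snd : IsRadialPotential d g Q fun r => f r ^ α
  pos : ∀ r, 0 < f r

namespace IsPositiveRadialSystem

variable {d : ℕ} {α : ℝ} {f P g Q : ℝ → ℝ}

theorem flux_snd_nonneg (H : IsPositiveRadialSystem d α f P g Q) {r : ℝ} (hr : 0 ≤ r) : 0 ≤ Q r :=
  H.snd.flux_nonneg (fun r _ => (Real.rpow_pos_of_pos (H.pos r) α).le) hr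

theorem monotoneOn_snd (H : IsPositiveRadialSystem d α f P g Q) : MonotoneOn g (Set.Ici 0) :=
  H.snd.monotoneOn le_rfl fun _ hr => H.flux_snd_nonneg hr.le

/-- The Laplacian of a positive solution cannot stay nonpositive. Otherwise `f` and `-g` are
positive and superharmonic, so that `r ^ (d - 1) * f r` is nondecreasing, whereas `f ≤ f 0` and
`α ≤ 1` give `f ^ α ≥ f 0 ^ (α - 1) * f`, which forces `f (4 * R) ≤ C * R ^ (-4) * f R`. -/
theorem exists_snd_pos (H : IsPositiveRadialSystem d α f P g Q) (hd : 2 ≤ d) (hα : α ≤ 1) :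
    ∃ r, 0 < r ∧ 0 < g r := by
  by_contra! hneg
  obtain ⟨k, rfl⟩ : ∃ k, d = k + 2 := ⟨d - 2, by omega⟩
  have hPneg : ∀ r, 0 ≤ r → P r ≤ 0 := fun r hr => by
    have := H.fst.neg.flux_nonneg (fun r hr => by simpa using hneg r hr) hr
    simpa using this
  have hanti : ∀ x y, 0 ≤ x → x ≤ y → f y ≤ f x := fun x y hx hxy => by
    have := H.fst.neg.monotoneOn le_rfl (fun r hr => by simpa using hPneg r hr.le)
      (Set.mem_Ici.2 hx) (Set.mem_Ici.2 (hx.trans hxy)) hxy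
    simpa using this
  set c : ℝ := f 0 ^ (α - 1) with hc
  have hcpos : 0 < c := Real.rpow_pos_of_pos (H.pos 0) _
  have hsrc : ∀ r, 0 ≤ r → c * f r ≤ f r ^ α := fun r hr => by
    have h1 : f r ^ α = f r ^ (α - 1) * f r := by
      rw [← Real.rpow_add_one (H.pos r).ne']; congr 1; ring
    rw [h1]
    have := Real.rpow_le_rpow_of_nonpos (H.pos r) (hanti 0 r le_rfl hr) (by linarith : α - 1 ≤ 0)
    exact mul_le_mul_of_nonneg_right this (H.pos r).le
  have hdecay : ∀ R, 0 < R →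
      9 / 4 * c * R ^ 4 / ((k + 2 : ℕ) + 1 : ℝ) ^ 2 * f (4 * R) ≤ f R := by
    intro R hR
    have h1 := H.snd.le_sub_of_le_source (K := c * f (4 * R)) hR
      (mul_pos hcpos (H.pos _)).le (H.flux_snd_nonneg hR.le) fun r hr =>
        (mul_le_mul_of_nonneg_left (hanti r (4 * R) (by linarith [hr.1]) hr.2) hcpos.le).trans
          (hsrc r (by linarith [hr.1]))
    have h2 := H.fst.neg.le_sub_of_le_source (R := R / 2) (K := -g (2 * R)) (by positivity)
      (by linarith [hneg (2 * R) (by positivity)])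
      (by simpa using hPneg (R / 2) (by positivity)) fun r hr => by
        have := H.monotoneOn_snd (Set.mem_Ici.2 (by linarith [hr.1] : 0 ≤ r))
          (Set.mem_Ici.2 (by linarith : 0 ≤ 2 * R)) (by linarith [hr.2])
        simpa using this
    simp only [Pi.neg_apply] at h2
    rw [show 2 * (R / 2) = R by ring] at h2
    have h3 : 3 * (c * f (4 * R)) * R ^ 2 / ((k + 2 : ℕ) + 1 : ℝ) ≤ -g (2 * R) := by
      linarith [hneg (4 * R) (by positivity)]
    have h4 : 3 * (3 * (c * f (4 * R)) * R ^ 2 / ((k + 2 : ℕ) + 1 : ℝ)) * (R / 2) ^ 2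
        / ((k + 2 : ℕ) + 1 : ℝ) ≤ f R := by
      refine le_trans ?_ (h2.trans (by linarith [H.pos (4 * (R / 2))]))
      gcongr
    refine le_trans (le_of_eq ?_) h4
    field_simp
    ring
  -- `k + 1` times `f` plus `r * f'` is nonincreasing; were it ever negative, `r ^ (k + 1) * f r`
  -- would decrease at least linearly and become negative.
  have hG : ∀ r, 0 < r → 0 ≤ ((k + 1 : ℕ) : ℝ) * f r + P r / r ^ (k + 1) := by
    intro r₀ hr₀
    by_contra! hlt
    set ε := -(((k + 1 : ℕ) : ℝ) * f r₀ + P r₀ / r₀ ^ (k + 1)) with hε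
    have hεpos : 0 < ε := by linarith
    have hGle : ∀ r, r₀ ≤ r → ((k + 1 : ℕ) : ℝ) * f r + P r / r ^ (k + 1) ≤ -ε := by
      intro r hr
      have := sub_le_sub_of_deriv_le (b := fun _ => (0 : ℝ)) (b' := fun _ => 0) hr
        (fun t ht => (H.fst.hasDerivAt_mul_add_flux
          (by linarith [ht.1] : 0 < t)).continuousAt.continuousWithinAt) continuousOn_const
        (fun t ht => H.fst.hasDerivAt_mul_add_flux (by linarith [ht.1]))
        (fun t _ => hasDerivAt_const t 0)
        (fun t ht => mul_nonpos_of_nonneg_of_nonpos (by linarith [ht.1])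
          (hneg t (by linarith [ht.1])))
      linarith
    have hle : ∀ r, r₀ ≤ r →
        r ^ (k + 1) * f r - r₀ ^ (k + 1) * f r₀ ≤ -(ε * r₀ ^ k) * r - -(ε * r₀ ^ k) * r₀ := by
      intro r hr
      refine sub_le_sub_of_deriv_le (a := fun r => r ^ (k + 1) * f r)
        (b := fun r => -(ε * r₀ ^ k) * r) (b' := fun _ => -(ε * r₀ ^ k))
        (a' := fun r => r ^ k * (((k + 1 : ℕ) : ℝ) * f r + P r / r ^ (k + 1))) hr
        ((continuous_pow _).mul H.fst.continuous).continuousOn (by fun_prop) (fun t ht => ?_)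
        (fun t _ => by simpa using (hasDerivAt_id t).const_mul (-(ε * r₀ ^ k))) (fun t ht => ?_)
      · exact H.fst.hasDerivAt_pow_mul (by linarith [ht.1])
      · have h1 := hGle t ht.1.le
        have h2 : r₀ ^ k ≤ t ^ k := by gcongr; exact ht.1.le
        have h3 : t ^ k * (((k + 1 : ℕ) : ℝ) * f t + P t / t ^ (k + 1)) ≤ t ^ k * -ε :=
          mul_le_mul_of_nonneg_left h1 (pow_nonneg (by linarith [ht.1]) k)
        have h4 : ε * r₀ ^ k ≤ ε * t ^ k := by gcongr
        linarith
    have hmpos : 0 < ε * r₀ ^ k := by positivity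
    have hA : 0 ≤ r₀ ^ (k + 1) * f r₀ / (ε * r₀ ^ k) := by
      have := H.pos r₀; positivity
    have h5 := hle (r₀ + r₀ ^ (k + 1) * f r₀ / (ε * r₀ ^ k)) (by linarith)
    have h6 : 0 < (r₀ + r₀ ^ (k + 1) * f r₀ / (ε * r₀ ^ k)) ^ (k + 1)
        * f (r₀ + r₀ ^ (k + 1) * f r₀ / (ε * r₀ ^ k)) := by
      have := H.pos (r₀ + r₀ ^ (k + 1) * f r₀ / (ε * r₀ ^ k)); positivity
    have h7 : ε * r₀ ^ k * (r₀ ^ (k + 1) * f r₀ / (ε * r₀ ^ k)) = r₀ ^ (k + 1) * f r₀ := by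
      field_simp
    linarith
  have hmono : ∀ R, 0 < R → f R ≤ 4 ^ (k + 1) * f (4 * R) := by
    intro R hR
    have := sub_le_sub_of_deriv_le (x := R) (y := 4 * R) (a := fun _ => (0 : ℝ)) (a' := fun _ => 0)
      (b := fun r => r ^ (k + 1) * f r)
      (b' := fun r => r ^ k * (((k + 1 : ℕ) : ℝ) * f r + P r / r ^ (k + 1))) (by linarith)
      continuousOn_const ((continuous_pow _).mul H.fst.continuous).continuousOn
      (fun t _ => hasDerivAt_const t 0) (fun t ht => H.fst.hasDerivAt_pow_mul (by linarith [ht.1]))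
      (fun t ht => mul_nonneg (pow_nonneg (by linarith [ht.1]) k) (hG t (by linarith [ht.1])))
    simp only [mul_pow, sub_zero] at this
    have h1 : R ^ (k + 1) * f R ≤ R ^ (k + 1) * (4 ^ (k + 1) * f (4 * R)) := by linarith
    exact le_of_mul_le_mul_left h1 (by positivity)
  set A : ℝ := 9 / 4 * c / ((k + 2 : ℕ) + 1 : ℝ) ^ 2 with hA
  have hApos : 0 < A := by positivity
  have hbound : ∀ R, 0 < R → A * R ^ 4 ≤ 4 ^ (k + 1) := by
    intro R hR
    have h1 := (hdecay R hR).trans (hmono R hR)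
    have h2 := le_of_mul_le_mul_right h1 (H.pos _)
    refine le_trans (le_of_eq ?_) h2
    rw [hA]; ring
  have h1 := hbound (1 + 4 ^ (k + 1) / A) (by positivity)
  have h2 : 1 + 4 ^ (k + 1) / A ≤ (1 + 4 ^ (k + 1) / A) ^ 4 :=
    le_self_pow₀ (by linarith [show (0 : ℝ) ≤ 4 ^ (k + 1) / A by positivity]) (by norm_num)
  have h3 := mul_le_mul_of_nonneg_left h2 hApos.le
  have h4 : A * (1 + 4 ^ (k + 1) / A) = A + 4 ^ (k + 1) := by field_simp
  linarith

theorem exists_forall_le_snd (H : IsPositiveRadialSystem d α f P g Q) (hd : 2 ≤ d) (hα : α ≤ 1) :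
    ∃ c, 0 < c ∧ ∀ᶠ r in atTop, c ≤ g r := by
  obtain ⟨r₀, hr₀, hg⟩ := H.exists_snd_pos hd hα
  refine ⟨g r₀, hg, ?_⟩
  filter_upwards [eventually_ge_atTop r₀] with r hr
  exact H.monotoneOn_snd (Set.mem_Ici.2 hr₀.le) (Set.mem_Ici.2 (hr₀.le.trans hr)) hr

theorem eventually_sq_le_fst (H : IsPositiveRadialSystem d α f P g Q) (hd : 2 ≤ d) (hα : α ≤ 1) :
    ∃ c, 0 < c ∧ ∀ᶠ r in atTop, c * r ^ 2 ≤ f r := by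
  obtain ⟨c, hc, hg⟩ := H.exists_forall_le_snd hd hα
  have hd' : (2 : ℝ) ≤ d := by exact_mod_cast hd
  obtain ⟨c', h1, h2⟩ := exists_between
    (show 0 < c / (2 * (2 + d - 1)) from div_pos hc (by linarith))
  refine ⟨c', h1, ?_⟩
  have := H.fst.eventually_rpow_le (q := 2) (K := c) two_pos (by linarith)
    (hg.mono fun r hr => by simpa using hr) h2
  exact this.mono fun r hr => by exact_mod_cast hr

theorem tendsto_fst (H : IsPositiveRadialSystem d α f P g Q) (hd : 2 ≤ d) (hα : α ≤ 1) :
    Tendsto f atTop atTop := by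
  obtain ⟨c, hc, h⟩ := H.eventually_sq_le_fst hd hα
  exact tendsto_atTop_mono' _ h ((tendsto_pow_atTop two_ne_zero).const_mul_atTop hc)

theorem eventually_flux_fst_pos (H : IsPositiveRadialSystem d α f P g Q) (hd : 2 ≤ d)
    (hα : α ≤ 1) : ∀ᶠ r in atTop, 0 < P r := by
  obtain ⟨c, hc, hg⟩ := H.exists_forall_le_snd hd hα
  have := eventually_le_mul_of_deriv_le (a := -P) (a' := fun r => -(r ^ d * g r))
    (b := fun r => r ^ (d + 1)) (b' := fun r => (d + 1) * r ^ d) (K := -(c / (d + 1)))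
    (K' := -(c / (d + 1) / 2)) (by have : 0 < c / (d + 1) := by positivity
                                   linarith)
    (by filter_upwards [eventually_gt_atTop 0] with r hr using (H.fst.flux_hasDerivAt r hr).neg)
    (Eventually.of_forall fun r => by simpa using hasDerivAt_pow (d + 1) r)
    (by
      filter_upwards [hg, eventually_gt_atTop 0] with r hr hr0
      have h1 : -(c / (d + 1)) * ((d + 1) * r ^ d) = -(r ^ d * c) := by field_simp
      rw [h1]
      exact neg_le_neg (mul_le_mul_of_nonneg_left hr (by positivity)))
    (tendsto_pow_atTop (by omega))
  filter_upwards [this, eventually_gt_atTop 0] with r hr hr0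
  have : 0 < c / (d + 1) / 2 * r ^ (d + 1) := by positivity
  simp only [Pi.neg_apply] at hr
  linarith

end IsPositiveRadialSystem

/-! ### The sublinear range `-1 < α < 1` -/

namespace IsRadialPotential

variable {d : ℕ} {f P h : ℝ → ℝ} {ρ K r : ℝ}

theorem flux_le_of_source_le (H : IsRadialPotential d f P h) (hh : ∀ r ∈ Set.Icc 0 ρ, h r ≤ K)
    (hr : r ∈ Set.Icc 0 ρ) : P r ≤ K / (d + 1) * r ^ (d + 1) := by
  have h1 := sub_le_sub_of_deriv_le (b := fun t => K / (d + 1) * t ^ (d + 1))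
    (b' := fun t => K * t ^ d) hr.1 H.flux_continuous.continuousOn (by fun_prop)
    (fun t ht => H.flux_hasDerivAt t ht.1)
    (fun t _ => ((hasDerivAt_pow (d + 1) t).const_mul (K / (d + 1))).congr_deriv (by
      push_cast; field_simp))
    (fun t ht => by
      rw [mul_comm K]
      exact mul_le_mul_of_nonneg_left (hh t ⟨ht.1.le, ht.2.le.trans hr.2⟩) (pow_nonneg ht.1.le d))
  rw [H.flux_zero] at h1
  simpa using h1

theorem le_of_source_le (H : IsRadialPotential d f P h) (hh : ∀ r ∈ Set.Icc 0 ρ, h r ≤ K)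
    (hr : r ∈ Set.Icc 0 ρ) : f r ≤ f 0 + K / (2 * (d + 1)) * r ^ 2 := by
  have h2 := sub_le_sub_of_deriv_le (b := fun t => K / (2 * (d + 1)) * t ^ 2)
    (b' := fun t => K / (d + 1) * t) hr.1 H.continuous.continuousOn (by fun_prop)
    (fun t ht => H.hasDerivAt t ht.1)
    (fun t _ => ((hasDerivAt_pow 2 t).const_mul (K / (2 * (d + 1)))).congr_deriv (by
      push_cast; field_simp))
    (fun t ht => by
      have htp : 0 < t := ht.1
      rw [div_le_iff₀ (by positivity)]
      refine (H.flux_le_of_source_le hh ⟨ht.1.le, ht.2.le.trans hr.2⟩).trans (le_of_eq ?_)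
      ring)
  simp only [ne_eq, OfNat.ofNat_ne_zero, not_false_eq_true, zero_pow, mul_zero, sub_zero] at h2
  linarith

end IsRadialPotential

namespace IsPositiveRadialSystem

variable {d : ℕ} {α p : ℝ} {f P g Q : ℝ → ℝ}

/-- A lower bound `m` of the source on `[R, 4 * R]` propagates, through both equations, to
`f (16 * R)`. -/
theorem eventually_le_fst_of_le_source (H : IsPositiveRadialSystem d α f P g Q) (hd : 2 ≤ d)
    (hα : α ≤ 1) : ∀ᶠ R in atTop, ∀ m, 0 ≤ m → (∀ r ∈ Set.Icc R (4 * R), m ≤ f r ^ α) →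
      144 / ((d : ℝ) + 1) ^ 2 * R ^ 4 * m ≤ f (16 * R) := by
  obtain ⟨c, hc, hg⟩ := H.exists_forall_le_snd hd hα
  obtain ⟨R₀, hR₀⟩ := eventually_atTop.1 (hg.and (H.eventually_flux_fst_pos hd hα))
  filter_upwards [eventually_gt_atTop 0, eventually_ge_atTop R₀] with R hR hRR m hm hsrc
  have h1 := H.snd.le_sub_of_le_source hR hm (H.flux_snd_nonneg hR.le) hsrc
  have h2 := (hR₀ (2 * R) (by linarith)).1
  have h3 : 3 * m * R ^ 2 / ((d : ℝ) + 1) ≤ g (4 * R) := by linarith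
  have h4 := H.fst.le_sub_of_le_source (R := 4 * R) (K := 3 * m * R ^ 2 / ((d : ℝ) + 1))
    (by linarith) (by positivity) (hR₀ (4 * R) (by linarith)).2.le fun r hr =>
      h3.trans (H.monotoneOn_snd (Set.mem_Ici.2 (by linarith))
        (Set.mem_Ici.2 (by linarith [hr.1])) hr.1)
  rw [show 4 * (4 * R) = 16 * R by ring] at h4
  have h5 := h4.trans (sub_le_self _ (H.pos _).le)
  refine le_trans (le_of_eq ?_) h5
  field_simp
  ring

theorem exists_monotoneOn_fst (H : IsPositiveRadialSystem d α f P g Q) (hd : 2 ≤ d)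
    (hα : α ≤ 1) : ∃ R₀, 0 < R₀ ∧ MonotoneOn f (Set.Ici R₀) := by
  obtain ⟨R, hR⟩ := eventually_atTop.1 (H.eventually_flux_fst_pos hd hα)
  refine ⟨max R 1, by positivity, H.fst.monotoneOn (by positivity) fun r hr => ?_⟩
  exact (hR r ((le_max_left R 1).trans hr.le)).le

/-- The lower bound `f ≥ c * r ^ p`, with `p = 4 / (1 - α)`, obtained from the comparison of
`f (16 * R)` with the values of `f` on `[R, 16 * R]`. -/
theorem exists_rpow_le_fst (H : IsPositiveRadialSystem d α f P g Q) (hd : 2 ≤ d) (hα : α < 1)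
    (hp : p = 4 / (1 - α)) : ∃ c, 0 < c ∧ ∀ᶠ r in atTop, c * r ^ p ≤ f r := by
  have h1α : 0 < 1 - α := by linarith
  obtain ⟨R₁, hR₁pos, hmono⟩ := H.exists_monotoneOn_fst hd hα.le
  obtain ⟨R₂, hR₂⟩ := eventually_atTop.1 (H.eventually_le_fst_of_le_source hd hα.le)
  set R₀ := max R₁ R₂ with hR₀
  have hR₀pos : 0 < R₀ := hR₁pos.trans_le (le_max_left _ _)
  set C : ℝ := 144 / ((d : ℝ) + 1) ^ 2 with hC
  have hCpos : 0 < C := by positivity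
  have hle : ∀ x y, R₀ ≤ x → x ≤ y → f x ≤ f y := fun x y hx hxy =>
    hmono (Set.mem_Ici.2 ((le_max_left _ _).trans hx))
      (Set.mem_Ici.2 ((le_max_left _ _).trans (hx.trans hxy))) hxy
  rcases lt_or_ge α 0 with hneg | hnonneg
  · -- `f ^ α` is decreasing, so its minimum on `[R, 4 * R]` is at least `f (16 * R) ^ α`.
    refine ⟨(C / 16 ^ 4) ^ (1 / (1 - α)), by positivity, ?_⟩
    filter_upwards [eventually_ge_atTop (16 * R₀)] with r hr
    have hRr : R₀ ≤ r / 16 := by linarith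
    have hr0 : 0 < r := by linarith
    have h1 := hR₂ (r / 16) ((le_max_right _ _).trans hRr) (f r ^ α)
      (Real.rpow_pos_of_pos (H.pos r) _).le fun t ht =>
        Real.rpow_le_rpow_of_nonpos (H.pos t) (hle t r (hRr.trans ht.1) (by linarith [ht.2]))
          hneg.le
    rw [show 16 * (r / 16) = r by ring] at h1
    have h2 : C / 16 ^ 4 * r ^ 4 ≤ f r ^ (1 - α) := by
      rw [Real.rpow_sub (H.pos r), Real.rpow_one,
        le_div_iff₀ (Real.rpow_pos_of_pos (H.pos r) _)]
      refine le_trans (le_of_eq ?_) h1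
      ring
    have h3 := Real.rpow_le_rpow (by positivity) h2 (by positivity : 0 ≤ 1 / (1 - α))
    rw [← Real.rpow_mul (H.pos r).le, mul_one_div_cancel h1α.ne', Real.rpow_one,
      Real.mul_rpow (by positivity) (by positivity), ← Real.rpow_natCast r 4,
      ← Real.rpow_mul hr0.le] at h3
    rw [hp]
    refine le_trans (le_of_eq ?_) h3
    congr 2
    push_cast; ring
  · -- `f ^ α` is increasing, so its minimum on `[R, 4 * R]` is `f R ^ α`, and a lower bound with a
    -- constant `ε` satisfying `ε ^ (1 - α) ≤ C / 16 ^ p` passes from `R` to `16 * R`.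
    set ε := min (f R₀ / (16 * R₀) ^ p) ((C / 16 ^ p) ^ (1 / (1 - α))) with hε
    have hεpos : 0 < ε := lt_min (div_pos (H.pos _) (by positivity)) (by positivity)
    have hppos : 0 < p := by rw [hp]; positivity
    have hεα : ε ≤ C / 16 ^ p * ε ^ α := by
      have h1 : ε ^ (1 - α) ≤ C / 16 ^ p := by
        refine (Real.rpow_le_rpow hεpos.le (min_le_right _ _) h1α.le).trans ?_
        rw [← Real.rpow_mul (by positivity), one_div_mul_cancel h1α.ne', Real.rpow_one]
      rw [Real.rpow_sub hεpos, Real.rpow_one, div_le_iff₀ (by positivity)] at h1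
      exact h1
    have hind : ∀ k : ℕ, ∀ r ∈ Set.Icc R₀ (16 ^ (k + 1) * R₀), ε * r ^ p ≤ f r := by
      have hbase : ∀ r ∈ Set.Icc R₀ (16 * R₀), ε * r ^ p ≤ f r := fun r hr => by
        have hr0 : 0 < r := hR₀pos.trans_le hr.1
        calc ε * r ^ p ≤ f R₀ / (16 * R₀) ^ p * (16 * R₀) ^ p := by
              gcongr
              · exact div_nonneg (H.pos _).le (by positivity)
              · exact min_le_left _ _
              · exact hr.2
          _ = f R₀ := div_mul_cancel₀ _ (by positivity)
          _ ≤ f r := hle _ _ le_rfl hr.1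
      intro k
      induction k with
      | zero => simpa using hbase
      | succ k ih =>
        intro r hr
        rcases le_total r (16 * R₀) with h16 | h16
        · exact hbase r ⟨hr.1, h16⟩
        have hr0 : 0 < r := hR₀pos.trans_le hr.1
        have hRr : R₀ ≤ r / 16 := by linarith
        have h1 := ih (r / 16) ⟨hRr, by
          have := hr.2
          rw [pow_succ] at this
          linarith⟩
        have h2 := hR₂ (r / 16) ((le_max_right _ _).trans hRr) (f (r / 16) ^ α)
          (Real.rpow_pos_of_pos (H.pos _) _).le fun t ht =>
            Real.rpow_le_rpow (H.pos _).le (hle _ t hRr ht.1) hnonneg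
        rw [show 16 * (r / 16) = r by ring] at h2
        have h3 := Real.rpow_le_rpow (by positivity) h1 hnonneg
        have h4 : (r / 16) ^ 4 * (ε * (r / 16) ^ p) ^ α = ε ^ α * (r ^ p / 16 ^ p) := by
          rw [Real.mul_rpow hεpos.le (by positivity), ← Real.rpow_mul (by positivity),
            mul_left_comm, ← Real.rpow_natCast (r / 16) 4, ← Real.rpow_add (by positivity),
            ← Real.div_rpow hr0.le (by norm_num)]
          congr 2
          rw [hp]; field_simp; push_cast; ring
        calc ε * r ^ p ≤ C / 16 ^ p * ε ^ α * r ^ p := by gcongr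
          _ = C * ((r / 16) ^ 4 * (ε * (r / 16) ^ p) ^ α) := by rw [h4]; ring
          _ ≤ C * ((r / 16) ^ 4 * f (r / 16) ^ α) := by gcongr
          _ ≤ f r := by rw [← mul_assoc]; exact h2
    refine ⟨ε, hεpos, ?_⟩
    filter_upwards [eventually_ge_atTop R₀] with r hr
    obtain ⟨k, hk⟩ := pow_unbounded_of_one_lt (r / R₀) (by norm_num : (1 : ℝ) < 16)
    refine hind k r ⟨hr, ?_⟩
    rw [div_lt_iff₀ hR₀pos] at hk
    refine hk.le.trans ?_
    gcongr
    · norm_num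
    · omega

/-- The constant `A` for which `Δ² r ^ p = A * r ^ (p - 4)` in dimension `d + 1`. -/
noncomputable def bilaplacianCoeff (d : ℕ) (p : ℝ) : ℝ :=
  (p - 2) * (p - 2 + d - 1) * (p * (p + d - 1))

theorem bilaplacianCoeff_pos (hd : 2 ≤ d) (hp : 2 < p) : 0 < bilaplacianCoeff d p := by
  have : (2 : ℝ) ≤ d := by exact_mod_cast hd
  have h1 : 0 < p - 2 := by linarith
  have h2 : 0 < p - 2 + d - 1 := by linarith
  have h3 : 0 < p + d - 1 := by linarith
  unfold bilaplacianCoeff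
  positivity

theorem eventually_fst_le_rpow_of_source_le (H : IsPositiveRadialSystem d α f P g Q) (hd : 2 ≤ d)
    (hp : 2 < p) {K K' : ℝ} (hsrc : ∀ᶠ r in atTop, f r ^ α ≤ K * r ^ (p - 4))
    (hK : K / bilaplacianCoeff d p < K') : ∀ᶠ r in atTop, f r ≤ K' * r ^ p := by
  have hd' : (2 : ℝ) ≤ d := by exact_mod_cast hd
  have h2 : 0 < p - 2 + d - 1 := by linarith
  have h3 : 0 < p + d - 1 := by linarith
  have h4 : 0 < p - 2 := by linarith
  rw [bilaplacianCoeff, ← div_div, div_lt_iff₀ (by positivity)] at hK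
  obtain ⟨L, hL1, hL2⟩ := exists_between hK
  have hg := H.snd.eventually_le_rpow (q := p - 2) h4 h2
    (hsrc.mono fun r hr => by rwa [show p - 2 - 2 = p - 4 by ring]) hL1
  exact H.fst.eventually_le_rpow (by linarith) h3 hg (by rwa [div_lt_iff₀ (by positivity)])

theorem eventually_rpow_le_fst_of_le_source (H : IsPositiveRadialSystem d α f P g Q) (hd : 2 ≤ d)
    (hp : 2 < p) {K K' : ℝ} (hsrc : ∀ᶠ r in atTop, K * r ^ (p - 4) ≤ f r ^ α)
    (hK : K' < K / bilaplacianCoeff d p) : ∀ᶠ r in atTop, K' * r ^ p ≤ f r := by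
  have hd' : (2 : ℝ) ≤ d := by exact_mod_cast hd
  have h2 : 0 < p - 2 + d - 1 := by linarith
  have h3 : 0 < p + d - 1 := by linarith
  have h4 : 0 < p - 2 := by linarith
  rw [bilaplacianCoeff, ← div_div, lt_div_iff₀ (by positivity)] at hK
  obtain ⟨L, hL1, hL2⟩ := exists_between hK
  have hg := H.snd.eventually_rpow_le (q := p - 2) h4 h2
    (hsrc.mono fun r hr => by rwa [show p - 2 - 2 = p - 4 by ring]) hL2
  exact H.fst.eventually_rpow_le (by linarith) h3 hg (by rwa [lt_div_iff₀ (by positivity)])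

theorem two_lt_exponent (h1 : -1 < α) (h2 : α < 1) (hp : p = 4 / (1 - α)) : 2 < p := by
  rw [hp, lt_div_iff₀ (by linarith)]; linarith

theorem mul_rpow_exponent (hα : α < 1) (hp : p = 4 / (1 - α)) {K r : ℝ} (hK : 0 ≤ K) (hr : 0 < r) :
    (K * r ^ p) ^ α = K ^ α * r ^ (p - 4) := by
  rw [Real.mul_rpow hK (by positivity), ← Real.rpow_mul hr.le]
  congr 2
  have : 1 - α ≠ 0 := by linarith
  rw [hp]; field_simp; ring

theorem exists_fst_le_rpow (H : IsPositiveRadialSystem d α f P g Q) (hd : 2 ≤ d) (h1 : -1 < α)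
    (h2 : α < 1) (hp : p = 4 / (1 - α)) : ∃ C, ∀ᶠ r in atTop, f r ≤ C * r ^ p := by
  have h1α : 0 < 1 - α := by linarith
  rcases lt_or_ge α 0 with hneg | hnonneg
  · obtain ⟨c, hc, hlow⟩ := H.exists_rpow_le_fst hd h2 hp
    refine ⟨_, H.eventually_fst_le_rpow_of_source_le hd (two_lt_exponent h1 h2 hp) (K := c ^ α) ?_
      (lt_add_one _)⟩
    filter_upwards [hlow, eventually_gt_atTop 0] with r hr hr0
    rw [← mul_rpow_exponent h2 hp hc.le hr0]
    exact Real.rpow_le_rpow_of_nonpos (by positivity) hr hneg.le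
  · -- As `f` is eventually increasing and unbounded, for large `ρ` its maximum over
    -- `[0, ρ]` is `f ρ`, so the source is at most `f ρ ^ α` there.
    obtain ⟨R₀, hR₀pos, hmono⟩ := H.exists_monotoneOn_fst hd h2.le
    obtain ⟨x, -, hx⟩ := isCompact_Icc.exists_isMaxOn (Set.nonempty_Icc.2 hR₀pos.le)
      (H.fst.continuous.continuousOn (s := Set.Icc 0 R₀))
    set C := f 0 + |g 0| + 1 with hC
    have hCpos : 0 < C := by have := H.pos 0; positivity
    refine ⟨C ^ (1 / (1 - α)), ?_⟩
    filter_upwards [(H.tendsto_fst hd h2.le).eventually_ge_atTop (max (f x) 1),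
      eventually_ge_atTop (max R₀ 1)] with ρ hρ hρ1
    have hρR : R₀ ≤ ρ := (le_max_left _ _).trans hρ1
    have hρ1 : 1 ≤ ρ := (le_max_right _ _).trans hρ1
    have hfρ : 1 ≤ f ρ := (le_max_right _ _).trans hρ
    have hle : ∀ t ∈ Set.Icc 0 ρ, f t ≤ f ρ := by
      intro t ht
      rcases le_total t R₀ with h | h
      · exact (hx ⟨ht.1, h⟩).trans ((le_max_left _ _).trans hρ)
      · exact hmono (Set.mem_Ici.2 h) (Set.mem_Ici.2 hρR) ht.2
    set K := f ρ ^ α with hK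
    have hK1 : 1 ≤ K := Real.one_le_rpow hfρ hnonneg
    have hg : ∀ t ∈ Set.Icc 0 ρ, g t ≤ |g 0| + K / (2 * (d + 1)) * ρ ^ 2 := by
      intro t ht
      have h3 := H.snd.le_of_source_le
        (fun s hs => Real.rpow_le_rpow (H.pos s).le (hle s hs) hnonneg) ht
      have h4 : K / (2 * (d + 1)) * t ^ 2 ≤ K / (2 * (d + 1)) * ρ ^ 2 := by
        have := ht.1; have := ht.2; gcongr
      linarith [le_abs_self (g 0)]
    have hf := H.fst.le_of_source_le hg ⟨by linarith, le_rfl⟩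
    have hd1 : 1 / (2 * ((d : ℝ) + 1)) ≤ 1 := by
      rw [div_le_one (by positivity)]; linarith [show (0 : ℝ) ≤ d from Nat.cast_nonneg d]
    have hKle : K / (2 * ((d : ℝ) + 1)) ≤ K := by
      rw [div_eq_mul_one_div]; exact mul_le_of_le_one_right (by linarith) hd1
    have hfle : f ρ ≤ C * ρ ^ 4 * K := by
      have hb : 0 ≤ |g 0| + K / (2 * ((d : ℝ) + 1)) * ρ ^ 2 := by positivity
      have h5 : (|g 0| + K / (2 * (d + 1)) * ρ ^ 2) / (2 * ((d : ℝ) + 1)) ≤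
          |g 0| + K / (2 * (d + 1)) * ρ ^ 2 := by
        rw [div_eq_mul_one_div]; exact mul_le_of_le_one_right hb hd1
      have h6 : (1 : ℝ) ≤ ρ ^ 2 := one_le_pow₀ hρ1
      have h7 : ρ ^ 2 * ρ ^ 2 = ρ ^ 4 := by ring
      have h8 : ρ ^ 2 ≤ ρ ^ 4 := by nlinarith
      have h9 : ρ ^ 4 ≤ ρ ^ 4 * K := le_mul_of_one_le_right (by positivity) hK1
      calc f ρ ≤ f 0 + (|g 0| + K / (2 * (d + 1)) * ρ ^ 2) * ρ ^ 2 := by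
            refine hf.trans ?_; gcongr
        _ = f 0 + |g 0| * ρ ^ 2 + K / (2 * (d + 1)) * ρ ^ 4 := by ring
        _ ≤ f 0 * (ρ ^ 4 * K) + |g 0| * (ρ ^ 4 * K) + K * ρ ^ 4 := by
            gcongr
            · exact le_mul_of_one_le_right (H.pos 0).le (by linarith)
            · linarith
        _ = C * ρ ^ 4 * K := by rw [hC]; ring
    have hpow : f ρ ^ (1 - α) ≤ C * ρ ^ 4 := by
      rw [Real.rpow_sub (H.pos ρ), Real.rpow_one, div_le_iff₀ (by positivity)]
      exact hfle
    have h10 := Real.rpow_le_rpow (by have := H.pos ρ; positivity) hpow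
      (by positivity : 0 ≤ 1 / (1 - α))
    rw [← Real.rpow_mul (H.pos ρ).le, mul_one_div_cancel h1α.ne', Real.rpow_one,
      Real.mul_rpow hCpos.le (by positivity), ← Real.rpow_natCast ρ 4,
      ← Real.rpow_mul (by linarith)] at h10
    refine h10.trans (le_of_eq ?_)
    rw [hp]
    congr 2
    push_cast; ring

/-- The two nonlinear inequalities between the lower limit `a` and the upper limit `b` of
`f / r ^ p` pin both down, for either monotonicity of `x ↦ x ^ α`. -/
theorem eq_of_limit_inequalities {a b A : ℝ} (ha : 0 < a) (hab : a ≤ b) (hA : 0 < A)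
    (h1 : -1 < α) (h2 : α < 1)
    (hpos : 0 ≤ α → b ≤ b ^ α / A ∧ a ^ α / A ≤ a)
    (hneg : α < 0 → b ≤ a ^ α / A ∧ b ^ α / A ≤ a) :
    a = A ^ (-(1 / (1 - α))) ∧ b = A ^ (-(1 / (1 - α))) := by
  have hb : 0 < b := ha.trans_le hab
  have h1α : 0 < 1 - α := by linarith
  have key : b ^ (1 - α) ≤ A⁻¹ ∧ A⁻¹ ≤ a ^ (1 - α) := by
    have hform : ∀ x : ℝ, 0 < x → x ^ (1 - α) = x / x ^ α := fun x hx => by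
      rw [Real.rpow_sub hx, Real.rpow_one]
    have haα : 0 < a ^ α := by positivity
    have hbα : 0 < b ^ α := by positivity
    rcases lt_or_ge α 0 with hα | hα
    · obtain ⟨h3, h4⟩ := hneg hα
      rw [le_div_iff₀ hA] at h3
      rw [div_le_iff₀ hA] at h4
      have hba : b ≤ a := by
        have h5 : b * b ^ α ≤ a * a ^ α := by
          have : (b * A) * b ^ α ≤ a ^ α * (a * A) := by gcongr
          refine le_of_mul_le_mul_right (a := A) ?_ hA
          linarith
        have hform' : ∀ x : ℝ, 0 < x → x * x ^ α = x ^ (1 + α) := fun x hx => by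
          rw [Real.rpow_add hx, Real.rpow_one]
        rw [hform' b hb, hform' a ha] at h5
        exact (Real.rpow_le_rpow_iff hb.le ha.le (by linarith)).1 h5
      have heq : a = b := le_antisymm hab hba
      subst heq
      rw [hform a ha, inv_eq_one_div, div_le_div_iff₀ haα hA, div_le_div_iff₀ hA haα]
      constructor <;> linarith
    · obtain ⟨h3, h4⟩ := hpos hα
      rw [le_div_iff₀ hA] at h3
      rw [div_le_iff₀ hA] at h4
      rw [hform a ha, hform b hb, inv_eq_one_div, div_le_div_iff₀ hbα hA, div_le_div_iff₀ hA haα]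
      constructor <;> linarith
  have hroot : ∀ x : ℝ, 0 < x → (x ^ (1 - α)) ^ (1 / (1 - α)) = x := fun x hx => by
    rw [← Real.rpow_mul hx.le, mul_one_div_cancel h1α.ne', Real.rpow_one]
  have h5 := Real.rpow_le_rpow (by positivity) key.1 (by positivity : 0 ≤ 1 / (1 - α))
  have h6 := Real.rpow_le_rpow (by positivity) key.2 (by positivity : 0 ≤ 1 / (1 - α))
  rw [hroot b hb, Real.inv_rpow hA.le, ← Real.rpow_neg hA.le] at h5
  rw [hroot a ha, Real.inv_rpow hA.le, ← Real.rpow_neg hA.le] at h6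
  constructor <;> linarith

theorem tendsto_fst_div_rpow (H : IsPositiveRadialSystem d α f P g Q) (hd : 2 ≤ d) (h1 : -1 < α)
    (h2 : α < 1) (hp : p = 4 / (1 - α)) :
    Tendsto (fun r => f r / r ^ p) atTop (𝓝 (bilaplacianCoeff d p ^ (-(1 / (1 - α))))) := by
  obtain ⟨c, hc, hlow⟩ := H.exists_rpow_le_fst hd h2 hp
  obtain ⟨C, hup⟩ := H.exists_fst_le_rpow hd h1 h2 hp
  have hp2 := two_lt_exponent h1 h2 hp
  have hA := bilaplacianCoeff_pos hd hp2
  set A := bilaplacianCoeff d p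
  set z : ℝ → ℝ := fun r => f r / r ^ p with hz
  have hzle : ∀ K, (∀ᶠ r in atTop, f r ≤ K * r ^ p) ↔ ∀ᶠ r in atTop, z r ≤ K := fun K =>
    eventually_congr (by
      filter_upwards [eventually_gt_atTop 0] with r hr
      rw [hz, div_le_iff₀ (by positivity)])
  have hlez : ∀ K, (∀ᶠ r in atTop, K * r ^ p ≤ f r) ↔ ∀ᶠ r in atTop, K ≤ z r := fun K =>
    eventually_congr (by
      filter_upwards [eventually_gt_atTop 0] with r hr
      rw [hz, le_div_iff₀ (by positivity)])
  have hbdd : IsBoundedUnder (· ≤ ·) atTop z := isBoundedUnder_of_eventually_le ((hzle C).1 hup)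
  have hbdd' : IsBoundedUnder (· ≥ ·) atTop z := isBoundedUnder_of_eventually_ge ((hlez c).1 hlow)
  set a := liminf z atTop with ha
  set b := limsup z atTop with hb
  have hab : a ≤ b := liminf_le_limsup hbdd hbdd'
  have hca : c ≤ a := le_liminf_of_le hbdd.isCoboundedUnder_ge ((hlez c).1 hlow)
  have hapos : 0 < a := hc.trans_le hca
  have hbpos : 0 < b := hapos.trans_le hab
  have hltb : ∀ B, b < B → ∀ᶠ r in atTop, f r ≤ B * r ^ p := fun B hB =>
    (hzle B).2 ((eventually_lt_of_limsup_lt hB hbdd).mono fun _ h => h.le)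
  have hlta : ∀ l, l < a → ∀ᶠ r in atTop, l * r ^ p ≤ f r := fun l hl =>
    (hlez l).2 ((eventually_lt_of_lt_liminf hl hbdd').mono fun _ h => h.le)
  have hble : ∀ K, (∀ᶠ r in atTop, f r ^ α ≤ K * r ^ (p - 4)) → b ≤ K / A := fun K hK =>
    le_of_forall_gt_imp_ge_of_dense fun K' hK' => limsup_le_of_le hbdd'.isCoboundedUnder_le
      ((hzle K').1 (H.eventually_fst_le_rpow_of_source_le hd hp2 hK hK'))
  have hlea : ∀ K, (∀ᶠ r in atTop, K * r ^ (p - 4) ≤ f r ^ α) → K / A ≤ a := fun K hK =>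
    le_of_forall_lt_imp_le_of_dense fun K' hK' => le_liminf_of_le hbdd.isCoboundedUnder_ge
      ((hlez K').1 (H.eventually_rpow_le_fst_of_le_source hd hp2 hK hK'))
  have hcont : ∀ x, 0 < x → Tendsto (fun t : ℝ => t ^ α / A) (𝓝 x) (𝓝 (x ^ α / A)) := fun x hx =>
    ((Real.continuousAt_rpow_const x α (Or.inl hx.ne')).div_const A)
  have hcontr : ∀ x, 0 < x → Tendsto (fun t : ℝ => t ^ α / A) (𝓝[>] x) (𝓝 (x ^ α / A)) :=
    fun x hx => (hcont x hx).mono_left nhdsWithin_le_nhds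
  have hcontl : ∀ x, 0 < x → Tendsto (fun t : ℝ => t ^ α / A) (𝓝[<] x) (𝓝 (x ^ α / A)) :=
    fun x hx => (hcont x hx).mono_left nhdsWithin_le_nhds
  have hapos' : ∀ᶠ l in 𝓝[<] a, 0 < l := nhdsWithin_le_nhds (lt_mem_nhds hapos)
  obtain ⟨hae, hbe⟩ := eq_of_limit_inequalities hapos hab hA h1 h2
    (fun hα => by
      constructor
      · refine ge_of_tendsto (hcontr b hbpos) ?_
        filter_upwards [self_mem_nhdsWithin] with B hB
        refine hble _ ?_
        filter_upwards [hltb B hB, eventually_gt_atTop 0] with r hr hr0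
        rw [← mul_rpow_exponent h2 hp (hbpos.trans hB).le hr0]
        exact Real.rpow_le_rpow (H.pos r).le hr hα
      · refine le_of_tendsto (hcontl a hapos) ?_
        filter_upwards [self_mem_nhdsWithin, hapos'] with l hl hl0
        refine hlea _ ?_
        filter_upwards [hlta l hl, eventually_gt_atTop 0] with r hr hr0
        rw [← mul_rpow_exponent h2 hp hl0.le hr0]
        exact Real.rpow_le_rpow (by positivity) hr hα)
    (fun hα => by
      constructor
      · refine ge_of_tendsto (hcontl a hapos) ?_
        filter_upwards [self_mem_nhdsWithin, hapos'] with l hl hl0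
        refine hble _ ?_
        filter_upwards [hlta l hl, eventually_gt_atTop 0] with r hr hr0
        rw [← mul_rpow_exponent h2 hp hl0.le hr0]
        exact Real.rpow_le_rpow_of_nonpos (by positivity) hr hα.le
      · refine le_of_tendsto (hcontr b hbpos) ?_
        filter_upwards [self_mem_nhdsWithin] with B hB
        refine hlea _ ?_
        filter_upwards [hltb B hB, eventually_gt_atTop 0] with r hr hr0
        rw [← mul_rpow_exponent h2 hp (hbpos.trans hB).le hr0]
        exact Real.rpow_le_rpow_of_nonpos (H.pos r) hr hα.le)
  exact tendsto_of_liminf_eq_limsup (ha.symm.trans hae) (hb.symm.trans hbe) hbdd hbdd'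

end IsPositiveRadialSystem

/-! ### The range `α ≤ -1` -/

theorem IsRadialPotential.tendsto_div_sq {d : ℕ} {f P h : ℝ → ℝ} (H : IsRadialPotential d f P h)
    {V : ℝ} (hh : Tendsto h atTop (𝓝 V)) :
    Tendsto (fun r => f r / r ^ 2) atTop (𝓝 (V / (2 * (d + 1)))) := by
  have hflux : Tendsto (fun r => P r / r ^ (d + 1)) atTop (𝓝 (V / (d + 1))) := by
    refine tendsto_div_of_tendsto_deriv_div (a' := fun r => r ^ d * h r)
      (b' := fun r => (d + 1) * r ^ d) ?_ ?_ ?_ (tendsto_pow_atTop (by omega)) ?_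
    · filter_upwards [eventually_gt_atTop 0] with r hr using H.flux_hasDerivAt r hr
    · exact Eventually.of_forall fun r => by simpa using hasDerivAt_pow (d + 1) r
    · filter_upwards [eventually_gt_atTop 0] with r hr
      positivity
    · refine (hh.div_const _).congr' ?_
      filter_upwards [eventually_gt_atTop 0] with r hr
      field_simp
  refine tendsto_div_of_tendsto_deriv_div (a' := fun r => P r / r ^ d)
    (b' := fun r => 2 * r) ?_ ?_ ?_ (tendsto_pow_atTop two_ne_zero) ?_
  · filter_upwards [eventually_gt_atTop 0] with r hr using H.hasDerivAt r hr
  · exact Eventually.of_forall fun r => by simpa using hasDerivAt_pow 2 r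
  · filter_upwards [eventually_gt_atTop 0] with r hr
    positivity
  · rw [mul_comm, ← div_div]
    refine (hflux.div_const _).congr' ?_
    filter_upwards [eventually_gt_atTop 0] with r hr
    field_simp
    ring

namespace IsPositiveRadialSystem

variable {d k : ℕ} {α : ℝ} {f P g Q : ℝ → ℝ}

theorem continuous_source (H : IsPositiveRadialSystem d α f P g Q) :
    Continuous fun r => f r ^ α :=
  H.fst.continuous.rpow_const fun r => Or.inl (H.pos r).ne'

theorem integrableOn_mul_source (H : IsPositiveRadialSystem d α f P g Q) (hd : 2 ≤ d)
    (hα : α < -1) : IntegrableOn (fun t => t * f t ^ α) (Set.Ioi 0) := by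
  obtain ⟨c, hc, hlow⟩ := H.eventually_sq_le_fst hd (by linarith)
  obtain ⟨R, hR⟩ := eventually_atTop.1 (hlow.and (eventually_gt_atTop 0))
  have hRpos : 0 < R := (hR R le_rfl).2
  have hcont : Continuous fun t => t * f t ^ α := continuous_id.mul H.continuous_source
  rw [← Set.Ioc_union_Ioi_eq_Ioi hRpos.le]
  refine ((hcont.integrableOn_Icc (a := 0) (b := R)).mono_set Set.Ioc_subset_Icc_self).union ?_
  have hint : IntegrableOn (fun t : ℝ => c ^ α * t ^ (1 + 2 * α)) (Set.Ioi R) :=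
    (integrableOn_Ioi_rpow_of_lt (by linarith) hRpos).const_mul _
  refine hint.mono' hcont.aestronglyMeasurable.restrict ?_
  filter_upwards [ae_restrict_mem measurableSet_Ioi] with t ht
  have ht0 : 0 < t := hRpos.trans ht
  rw [Real.norm_of_nonneg (mul_nonneg ht0.le (Real.rpow_pos_of_pos (H.pos t) α).le)]
  have h1 := Real.rpow_le_rpow_of_nonpos (by positivity) (hR t (Set.mem_Ioi.1 ht).le).1
    (by linarith : α ≤ 0)
  calc t * f t ^ α ≤ t * (c * t ^ 2) ^ α := by gcongr
    _ = c ^ α * t ^ (1 + 2 * α) := by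
      rw [Real.mul_rpow hc.le (by positivity), ← Real.rpow_natCast t 2, ← Real.rpow_mul ht0.le,
        Real.rpow_add ht0, Real.rpow_one]
      push_cast; ring

/-- The first integral of `(d - 1) * g + r * g'`. -/
theorem mul_snd_add_flux_eq (H : IsPositiveRadialSystem (k + 1) α f P g Q) {r : ℝ} (hr : 0 < r) :
    k * g r + Q r / r ^ k = k * g 0 + ∫ t in (0 : ℝ)..r, t * f t ^ α := by
  have hcont : Continuous fun t => t * f t ^ α := continuous_id.mul H.continuous_source
  have hfl : Tendsto (fun s => Q s / s ^ k) (𝓝[>] 0) (𝓝 0) := by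
    obtain ⟨x, -, hx⟩ := isCompact_Icc.exists_isMaxOn (Set.nonempty_Icc.2 zero_le_one)
      (H.continuous_source.continuousOn (s := Set.Icc 0 1))
    have hbd : Tendsto (fun s : ℝ => f x ^ α / ((k + 1 : ℕ) + 1) * s ^ 2) (𝓝[>] 0) (𝓝 0) := by
      have : Continuous fun s : ℝ => f x ^ α / ((k + 1 : ℕ) + 1) * s ^ 2 := by fun_prop
      exact (tendsto_nhdsWithin_of_tendsto_nhds (this.tendsto' 0 0 (by simp)))
    refine squeeze_zero' ?_ ?_ hbd
    · filter_upwards [self_mem_nhdsWithin] with s hs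
      have hs0 : 0 < s := hs
      exact div_nonneg (H.flux_snd_nonneg hs0.le) (by positivity)
    · filter_upwards [Ioc_mem_nhdsGT zero_lt_one] with s hs
      have hs0 : 0 < s := hs.1
      rw [div_le_iff₀ (by positivity)]
      refine (H.snd.flux_le_of_source_le (fun t ht => hx ht) ⟨hs0.le, hs.2⟩).trans (le_of_eq ?_)
      ring
  set D : ℝ → ℝ := fun s => k * g s + Q s / s ^ k - ∫ t in (0 : ℝ)..s, t * f t ^ α with hD
  have hDder : ∀ s, 0 < s → HasDerivAt D 0 s := fun s hs => by
    refine ((H.snd.hasDerivAt_mul_add_flux hs).sub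
      (hcont.integral_hasStrictDerivAt 0 s).hasDerivAt).congr_deriv (by simp)
  have hconst : ∀ s, 0 < s → s ≤ r → D s = D r := by
    intro s hs hsr
    have hc : ContinuousOn D (Set.Icc s r) := fun t ht =>
      (hDder t (hs.trans_le ht.1)).continuousAt.continuousWithinAt
    exact (constant_of_has_deriv_right_zero hc (fun t ht =>
      (hDder t (hs.trans_le ht.1)).hasDerivWithinAt) r ⟨hsr, le_rfl⟩).symm
  have hlim : Tendsto D (𝓝[>] 0) (𝓝 (k * g 0 + 0 - 0)) := by
    refine ((((H.snd.continuous.tendsto 0).mono_left nhdsWithin_le_nhds).const_mul _).add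
      hfl).sub ?_
    have : Continuous fun s => ∫ t in (0 : ℝ)..s, t * f t ^ α :=
      intervalIntegral.continuous_primitive (fun a b => hcont.intervalIntegrable a b) 0
    exact (this.tendsto' 0 0 (by simp)).mono_left nhdsWithin_le_nhds
  have hlim' : Tendsto D (𝓝[>] 0) (𝓝 (D r)) := by
    refine tendsto_const_nhds.congr' ?_
    filter_upwards [Ioc_mem_nhdsGT hr] with s hs using (hconst s hs.1 hs.2).symm
  have := tendsto_nhds_unique hlim hlim'
  simp only [hD] at this
  linarith

/-- The Laplacian of a solution converges when the source is integrable against `t`. -/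
theorem tendsto_snd (H : IsPositiveRadialSystem (k + 1) α f P g Q) (hk : 1 ≤ k)
    (hint : IntegrableOn (fun t => t * f t ^ α) (Set.Ioi 0)) :
    Tendsto g atTop (𝓝 (g 0 + 1 / k * ∫ t in Set.Ioi 0, t * f t ^ α)) := by
  have hk0 : (0 : ℝ) < k := by exact_mod_cast hk
  set I := ∫ t in Set.Ioi 0, t * f t ^ α with hI
  have h1 : Tendsto (fun r => k * g r + Q r / r ^ k) atTop (𝓝 (k * g 0 + I)) := by
    refine (((intervalIntegral_tendsto_integral_Ioi 0 hint tendsto_id).const_add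
      (k * g 0)).congr' ?_)
    filter_upwards [eventually_gt_atTop 0] with r hr using (H.mul_snd_add_flux_eq hr).symm
  have hle : ∀ r, 0 < r → g r ≤ g 0 + 1 / k * I := by
    intro r hr
    have h2 := H.mul_snd_add_flux_eq hr
    have h3 : ∫ t in (0 : ℝ)..r, t * f t ^ α ≤ I := by
      rw [intervalIntegral.integral_of_le hr.le]
      refine setIntegral_mono_set hint ?_ (Set.Ioc_subset_Ioi_self).eventuallyLE
      filter_upwards [ae_restrict_mem measurableSet_Ioi] with t ht
      have ht0 : 0 < t := ht
      exact mul_nonneg ht0.le (Real.rpow_pos_of_pos (H.pos t) α).le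
    have h4 : 0 ≤ Q r / r ^ k := div_nonneg (H.flux_snd_nonneg hr.le) (by positivity)
    have h5 : k * g r ≤ k * (g 0 + 1 / k * I) := by
      rw [mul_add, ← mul_assoc, mul_one_div_cancel hk0.ne']; linarith
    exact le_of_mul_le_mul_left h5 hk0
  obtain ⟨V, hV⟩ : ∃ V, Tendsto g atTop (𝓝 V) := by
    have hmono : Monotone fun r => g (max r 0) := fun x y hxy =>
      H.monotoneOn_snd (Set.mem_Ici.2 (le_max_right _ _)) (Set.mem_Ici.2 (le_max_right _ _))
        (max_le_max hxy le_rfl)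
    rcases tendsto_atTop_of_monotone hmono with h | ⟨V, h⟩
    · obtain ⟨r, hr, hr0⟩ := ((h.eventually_gt_atTop (g 0 + 1 / k * I)).and
        (eventually_gt_atTop 0)).exists
      rw [max_eq_left hr0.le] at hr
      exact absurd (hle r hr0) (not_le.2 hr)
    · refine ⟨V, h.congr' ?_⟩
      filter_upwards [eventually_ge_atTop 0] with r hr
      rw [max_eq_left hr]
  -- `r * g'` has a limit; a nonzero one would make `g` grow logarithmically.
  have hQ : Tendsto (fun r => Q r / r ^ k) atTop (𝓝 (k * g 0 + I - k * V)) := by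
    refine (h1.sub (hV.const_mul (k : ℝ))).congr fun r => by ring
  have hlog : Tendsto (fun r => g r / Real.log r) atTop (𝓝 (k * g 0 + I - k * V)) := by
    refine tendsto_div_of_tendsto_deriv_div (a' := fun r => Q r / r ^ (k + 1))
      (b' := fun r => r⁻¹) ?_ ?_ ?_ Real.tendsto_log_atTop ?_
    · filter_upwards [eventually_gt_atTop 0] with r hr using H.snd.hasDerivAt r hr
    · filter_upwards [eventually_gt_atTop 0] with r hr using Real.hasDerivAt_log hr.ne'
    · filter_upwards [eventually_gt_atTop 0] with r hr using inv_pos.2 hr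
    · refine hQ.congr' ?_
      filter_upwards [eventually_gt_atTop 0] with r hr
      field_simp
      ring
  have hzero := tendsto_nhds_unique hlog (hV.div_atTop Real.tendsto_log_atTop)
  have : V = g 0 + 1 / k * I := by
    field_simp
    linarith
  rwa [← this]

end IsPositiveRadialSystem

namespace IsPositiveRadialSystem

variable {k : ℕ} {f P g Q : ℝ → ℝ}

/-- For `α = -1` the quantity `r * g'` is bounded. -/
theorem exists_flux_snd_le (H : IsPositiveRadialSystem (k + 1) (-1) f P g Q) (hk : 1 ≤ k) :
    ∃ C, ∀ᶠ r in atTop, Q r / r ^ k ≤ C := by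
  obtain ⟨c, hc, hlow⟩ := H.eventually_sq_le_fst (by omega) (by norm_num)
  obtain ⟨m, rfl⟩ : ∃ m, k = m + 1 := ⟨k - 1, by omega⟩
  refine ⟨1 / (c * (m + 1)) + 1, ?_⟩
  have h := eventually_le_mul_of_deriv_le (a := Q) (a' := fun r => r ^ (m + 1 + 1) * f r ^ (-1 : ℝ))
    (b := fun r => r ^ (m + 1)) (b' := fun r => (m + 1) * r ^ m) (lt_add_one (1 / (c * (m + 1))))
    (by filter_upwards [eventually_gt_atTop 0] with r hr using H.snd.flux_hasDerivAt r hr)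
    (Eventually.of_forall fun r => by simpa using hasDerivAt_pow (m + 1) r)
    (by
      filter_upwards [hlow, eventually_gt_atTop 0] with r hr hr0
      rw [Real.rpow_neg_one]
      calc r ^ (m + 1 + 1) * (f r)⁻¹ ≤ r ^ (m + 1 + 1) * (c * r ^ 2)⁻¹ := by gcongr
        _ = 1 / (c * (m + 1)) * ((m + 1) * r ^ m) := by field_simp; ring)
    (tendsto_pow_atTop (by omega))
  filter_upwards [h, eventually_gt_atTop 0] with r hr hr0
  rwa [div_le_iff₀ (by positivity)]

/-- For `α = -1` the Laplacian of a solution is unbounded: otherwise `f ≤ K * r ^ 2`, so that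
`r * g'` is bounded below and `g` grows logarithmically. -/
theorem tendsto_snd_atTop (H : IsPositiveRadialSystem (k + 1) (-1) f P g Q) (hk : 1 ≤ k) :
    Tendsto g atTop atTop := by
  have hmono : Monotone fun r => g (max r 0) := fun x y hxy =>
    H.monotoneOn_snd (Set.mem_Ici.2 (le_max_right _ _)) (Set.mem_Ici.2 (le_max_right _ _))
      (max_le_max hxy le_rfl)
  have heq : (fun r => g (max r 0)) =ᶠ[atTop] g := by
    filter_upwards [eventually_ge_atTop 0] with r hr
    rw [max_eq_left hr]
  rcases tendsto_atTop_of_monotone hmono with h | ⟨V, h⟩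
  · exact h.congr' heq
  exfalso
  have hV : Tendsto g atTop (𝓝 V) := h.congr' heq
  have hVpos : 0 < V := by
    obtain ⟨c, hc, hg⟩ := H.exists_forall_le_snd (by omega) (by norm_num)
    exact hc.trans_le (ge_of_tendsto hV hg)
  have hf := H.fst.tendsto_div_sq hV
  set L := V / (2 * (((k + 1 : ℕ) : ℝ) + 1)) with hL
  have hLpos : 0 < L := by positivity
  have hk0 : (0 : ℝ) < k := by exact_mod_cast hk
  obtain ⟨m, rfl⟩ : ∃ m, k = m + 1 := ⟨k - 1, by omega⟩
  have hQ : Tendsto (fun r => Q r / r ^ (m + 1)) atTop (𝓝 (L⁻¹ / ((m + 1 : ℕ) : ℝ))) := by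
    refine tendsto_div_of_tendsto_deriv_div (a' := fun r => r ^ (m + 1 + 1) * f r ^ (-1 : ℝ))
      (b' := fun r => ((m + 1 : ℕ) : ℝ) * r ^ m) ?_ ?_ ?_ (tendsto_pow_atTop (by omega)) ?_
    · filter_upwards [eventually_gt_atTop 0] with r hr using H.snd.flux_hasDerivAt r hr
    · exact Eventually.of_forall fun r => by simpa using hasDerivAt_pow (m + 1) r
    · filter_upwards [eventually_gt_atTop 0] with r hr
      positivity
    · refine ((hf.inv₀ hLpos.ne').div_const _).congr' ?_
      filter_upwards [eventually_gt_atTop 0] with r hr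
      have := (H.pos r).ne'
      rw [Real.rpow_neg_one]
      field_simp
      ring
  have hlog : Tendsto (fun r => g r / Real.log r) atTop (𝓝 (L⁻¹ / ((m + 1 : ℕ) : ℝ))) := by
    refine tendsto_div_of_tendsto_deriv_div (a' := fun r => Q r / r ^ (m + 1 + 1))
      (b' := fun r => r⁻¹) ?_ ?_ ?_ Real.tendsto_log_atTop ?_
    · filter_upwards [eventually_gt_atTop 0] with r hr using H.snd.hasDerivAt r hr
    · filter_upwards [eventually_gt_atTop 0] with r hr using Real.hasDerivAt_log hr.ne'
    · filter_upwards [eventually_gt_atTop 0] with r hr using inv_pos.2 hr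
    · refine hQ.congr' ?_
      filter_upwards [eventually_gt_atTop 0] with r hr
      field_simp
      ring
  have hzero := tendsto_nhds_unique hlog (hV.div_atTop Real.tendsto_log_atTop)
  have : 0 < L⁻¹ / ((m + 1 : ℕ) : ℝ) := by positivity
  linarith

/-- For `α = -1`, `g` varies slowly, so `f` behaves like `r ^ 2 * g / (2 * n)`, the source like
its inverse, and `g * g'` like `2 * n / ((n - 2) * r)`; the last relation integrates to
`g ^ 2 ∼ 4 * n / (n - 2) * log r`. -/
theorem tendsto_fst_div_sq_mul_sqrt_log (H : IsPositiveRadialSystem (k + 1) (-1) f P g Q)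
    (hk : 1 ≤ k) :
    Tendsto (fun r => f r / (r ^ 2 * √(Real.log r))) atTop
      (𝓝 (√(((k + 1 : ℕ) + 1 : ℝ) * k))⁻¹) := by
  obtain ⟨C, hC⟩ := H.exists_flux_snd_le hk
  have hg := H.tendsto_snd_atTop hk
  have hk0 : (0 : ℝ) < k := by exact_mod_cast hk
  obtain ⟨m, rfl⟩ : ∃ m, k = m + 1 := ⟨k - 1, by omega⟩
  set n : ℝ := ((m + 1 + 1 : ℕ) : ℝ) + 1 with hn
  have hnpos : 0 < n := by positivity
  have hdg : ∀ r, 0 < r → HasDerivAt g (Q r / r ^ (m + 1 + 1)) r := H.snd.hasDerivAt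
  have hbounded : ∀ b : ℝ → ℝ, Tendsto b atTop atTop →
      Tendsto (fun r => Q r / r ^ (m + 1) / b r) atTop (𝓝 0) := by
    intro b hb
    refine squeeze_zero' ?_ ?_ (tendsto_const_nhds.div_atTop hb : Tendsto (fun r => C / b r) _ _)
    · filter_upwards [eventually_gt_atTop 0, hb.eventually_gt_atTop 0] with r hr hb0
      exact div_nonneg (div_nonneg (H.flux_snd_nonneg hr.le) (by positivity)) hb0.le
    · filter_upwards [hC, hb.eventually_gt_atTop 0] with r hr hb0
      gcongr
  set φ : ℝ → ℝ := fun r => Q r / r ^ (m + 1) / g r with hφ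
  have hφ0 : Tendsto φ atTop (𝓝 0) := hbounded g hg
  have hφnonneg : ∀ᶠ r in atTop, 0 ≤ φ r := by
    filter_upwards [eventually_gt_atTop 0, hg.eventually_gt_atTop 0] with r hr hg0
    exact div_nonneg (div_nonneg (H.flux_snd_nonneg hr.le) (by positivity)) hg0.le
  have hP : Tendsto (fun r => P r / (r ^ (m + 1 + 1 + 1) * g r)) atTop (𝓝 (1 / (n + 0))) := by
    refine tendsto_div_of_tendsto_deriv_div (a' := fun r => r ^ (m + 1 + 1) * g r)
      (b' := fun r => r ^ (m + 1 + 1) * g r * (n + φ r)) ?_ ?_ ?_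
      ((tendsto_pow_atTop (by omega)).atTop_mul_atTop₀ hg) ?_
    · filter_upwards [eventually_gt_atTop 0] with r hr using H.fst.flux_hasDerivAt r hr
    · filter_upwards [eventually_gt_atTop 0, hg.eventually_gt_atTop 0] with r hr hg0
      refine ((hasDerivAt_pow (m + 1 + 1 + 1) r).mul (hdg r hr)).congr_deriv ?_
      simp only [hφ, hn, Nat.add_sub_cancel]
      push_cast
      field_simp
      ring
    · filter_upwards [eventually_gt_atTop 0, hg.eventually_gt_atTop 0, hφnonneg] with r hr hg0 h0
      positivity
    · refine (tendsto_const_nhds.div (hφ0.const_add n) (by simpa using hnpos.ne')).congr' ?_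
      filter_upwards [eventually_gt_atTop 0, hg.eventually_gt_atTop 0] with r hr hg0
      simp only [Pi.div_apply]
      field_simp
  rw [add_zero] at hP
  have hf : Tendsto (fun r => f r / (r ^ 2 * g r)) atTop (𝓝 (1 / n / (2 + 0))) := by
    refine tendsto_div_of_tendsto_deriv_div (a' := fun r => P r / r ^ (m + 1 + 1))
      (b' := fun r => r * g r * (2 + φ r)) ?_ ?_ ?_
      ((tendsto_pow_atTop two_ne_zero).atTop_mul_atTop₀ hg) ?_
    · filter_upwards [eventually_gt_atTop 0] with r hr using H.fst.hasDerivAt r hr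
    · filter_upwards [eventually_gt_atTop 0, hg.eventually_gt_atTop 0] with r hr hg0
      refine ((hasDerivAt_pow 2 r).mul (hdg r hr)).congr_deriv ?_
      simp only [hφ]
      push_cast
      field_simp
      ring
    · filter_upwards [eventually_gt_atTop 0, hg.eventually_gt_atTop 0, hφnonneg] with r hr hg0 h0
      positivity
    · refine (hP.div (hφ0.const_add 2) (by norm_num)).congr' ?_
      filter_upwards [eventually_gt_atTop 0, hg.eventually_gt_atTop 0] with r hr hg0
      simp only [Pi.div_apply]
      field_simp
      ring
  rw [add_zero] at hf
  have hquot : Tendsto (fun r => r ^ (m + 1) / g r) atTop atTop := by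
    have h0 : Tendsto (fun r => g r / r ^ (m + 1)) atTop (𝓝 0) := by
      refine tendsto_div_of_tendsto_deriv_div (a' := fun r => Q r / r ^ (m + 1 + 1))
        (b' := fun r => ((m + 1 : ℕ) : ℝ) * r ^ m) ?_ ?_ ?_ (tendsto_pow_atTop (by omega)) ?_
      · filter_upwards [eventually_gt_atTop 0] with r hr using hdg r hr
      · exact Eventually.of_forall fun r => by simpa using hasDerivAt_pow (m + 1) r
      · filter_upwards [eventually_gt_atTop 0] with r hr
        positivity
      · refine (hbounded (fun r => ((m + 1 : ℕ) : ℝ) * r ^ (m + 1))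
          ((tendsto_pow_atTop (by omega)).const_mul_atTop hk0)).congr' ?_
        filter_upwards [eventually_gt_atTop 0] with r hr
        field_simp
        ring
    have h1 : Tendsto (fun r => g r / r ^ (m + 1)) atTop (𝓝[>] 0) := by
      refine tendsto_nhdsWithin_iff.2 ⟨h0, ?_⟩
      filter_upwards [eventually_gt_atTop 0, hg.eventually_gt_atTop 0] with r hr hg0
      exact div_pos hg0 (by positivity)
    exact (h1.inv_tendsto_nhdsGT_zero).congr fun r => by simp
  have hQ : Tendsto (fun r => Q r / (r ^ (m + 1) / g r)) atTop
      (𝓝 ((1 / n / 2)⁻¹ / (((m + 1 : ℕ) : ℝ) - 0))) := by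
    refine tendsto_div_of_tendsto_deriv_div (a' := fun r => r ^ (m + 1 + 1) * f r ^ (-1 : ℝ))
      (b' := fun r => r ^ m / g r * (((m + 1 : ℕ) : ℝ) - φ r)) ?_ ?_ ?_ hquot ?_
    · filter_upwards [eventually_gt_atTop 0] with r hr using H.snd.flux_hasDerivAt r hr
    · filter_upwards [eventually_gt_atTop 0, hg.eventually_gt_atTop 0] with r hr hg0
      refine ((hasDerivAt_pow (m + 1) r).div (hdg r hr) hg0.ne').congr_deriv ?_
      simp only [hφ, Nat.add_sub_cancel]
      field_simp
      ring
    · filter_upwards [eventually_gt_atTop 0, hg.eventually_gt_atTop 0,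
        (tendsto_order.1 hφ0).2 _ hk0] with r hr hg0 h0
      exact mul_pos (by positivity) (sub_pos.2 h0)
    · refine ((hf.inv₀ (by positivity)).div (hφ0.const_sub _) (by simpa using hk0.ne')).congr' ?_
      filter_upwards [eventually_gt_atTop 0, hg.eventually_gt_atTop 0,
        (tendsto_order.1 hφ0).2 _ hk0] with r hr hg0 h0
      have := (H.pos r).ne'
      have := (sub_pos.2 h0).ne'
      rw [Real.rpow_neg_one]
      simp only [Pi.div_apply]
      field_simp
      ring
  rw [sub_zero] at hQ
  have hsq : Tendsto (fun r => g r ^ 2 / Real.log r) atTop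
      (𝓝 (2 * ((1 / n / 2)⁻¹ / ((m + 1 : ℕ) : ℝ)))) := by
    refine tendsto_div_of_tendsto_deriv_div (a' := fun r => 2 * g r * (Q r / r ^ (m + 1 + 1)))
      (b' := fun r => r⁻¹) ?_ ?_ ?_ Real.tendsto_log_atTop ?_
    · filter_upwards [eventually_gt_atTop 0] with r hr
      exact ((hdg r hr).pow 2).congr_deriv (by simp)
    · filter_upwards [eventually_gt_atTop 0] with r hr using Real.hasDerivAt_log hr.ne'
    · filter_upwards [eventually_gt_atTop 0] with r hr using inv_pos.2 hr
    · refine (hQ.const_mul 2).congr' ?_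
      filter_upwards [eventually_gt_atTop 0, hg.eventually_gt_atTop 0] with r hr hg0
      field_simp
      ring
  have hfin := hf.mul hsq.sqrt
  have hval : 1 / n / 2 * √(2 * ((1 / n / 2)⁻¹ / ((m + 1 : ℕ) : ℝ)))
      = (√(n * ((m + 1 : ℕ) : ℝ)))⁻¹ := by
    have h1 : 2 * ((1 / n / 2)⁻¹ / ((m + 1 : ℕ) : ℝ)) = (2 * n) ^ 2 / (n * ((m + 1 : ℕ) : ℝ)) := by
      field_simp
    rw [h1, Real.sqrt_div (by positivity), Real.sqrt_sq (by positivity)]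
    field_simp
  rw [hval] at hfin
  refine hfin.congr' ?_
  filter_upwards [eventually_gt_atTop 1, hg.eventually_gt_atTop 0] with r hr hg0
  have hlog := Real.sqrt_pos.2 (Real.log_pos hr)
  rw [Real.sqrt_div (by positivity), Real.sqrt_sq hg0.le]
  field_simp

end IsPositiveRadialSystem

/-! ### The linear case `α = 1` -/

theorem hasDerivAt_integral_mul_exp_mul_cos {a : ℝ → ℝ} (ha : Continuous a) (r : ℝ) :
    HasDerivAt (fun r => ∫ θ in (0 : ℝ)..Real.pi, a θ * Real.exp (r * Real.cos θ))
      (∫ θ in (0 : ℝ)..Real.pi, Real.cos θ * a θ * Real.exp (r * Real.cos θ)) r := by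
  have hmeas : ∀ b : ℝ → ℝ, Continuous b → ∀ x : ℝ,
      Continuous fun θ => b θ * Real.exp (x * Real.cos θ) := fun b hb x => by fun_prop
  refine (intervalIntegral.hasDerivAt_integral_of_dominated_loc_of_deriv_le
    (F := fun x θ => a θ * Real.exp (x * Real.cos θ))
    (F' := fun x θ => Real.cos θ * a θ * Real.exp (x * Real.cos θ))
    (bound := fun θ => |a θ| * Real.exp (|r| + 1)) (Metric.ball_mem_nhds r one_pos)
    (Eventually.of_forall fun x => (hmeas a ha x).aestronglyMeasurable)
    ((hmeas a ha r).intervalIntegrable _ _)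
    (hmeas _ (Real.continuous_cos.mul ha) r).aestronglyMeasurable ?_
    ((ha.abs.mul continuous_const).intervalIntegrable _ _) ?_).2
  · refine Eventually.of_forall fun θ _ x hx => ?_
    rw [norm_mul, norm_mul, Real.norm_eq_abs, Real.norm_eq_abs, Real.norm_eq_abs, Real.abs_exp]
    have hx1 : |x| ≤ |r| + 1 := by
      rw [Metric.mem_ball, Real.dist_eq] at hx
      linarith [abs_sub_abs_le_abs_sub x r]
    have hexp : x * Real.cos θ ≤ |r| + 1 := by
      refine (le_abs_self _).trans ?_
      rw [abs_mul]
      exact (mul_le_of_le_one_right (abs_nonneg x) (Real.abs_cos_le_one θ)).trans hx1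
    have h1 : |Real.cos θ| * |a θ| ≤ |a θ| :=
      mul_le_of_le_one_left (abs_nonneg _) (Real.abs_cos_le_one θ)
    gcongr
  · refine Eventually.of_forall fun θ _ x _ => ?_
    exact (((hasDerivAt_id x).mul_const (Real.cos θ)).exp.const_mul (a θ)).congr_deriv (by
      simp only [id]; ring)

/-- Poisson's integral `∫ sin θ ^ k * exp (r * cos θ)` over `[0, π]`: up to a constant factor, the
radial solution of `Δ s = s` in dimension `k + 2`, that is, `r ^ (-k / 2)` times the modified Bessel
function of order `k / 2`. -/
noncomputable def poissonIntegral (k : ℕ) (r : ℝ) : ℝ :=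
  ∫ θ in (0 : ℝ)..Real.pi, Real.sin θ ^ k * Real.exp (r * Real.cos θ)

theorem poissonIntegral_pos (k : ℕ) (r : ℝ) : 0 < poissonIntegral k r := by
  refine intervalIntegral.intervalIntegral_pos_of_pos_on ?_ (fun θ hθ => ?_) Real.pi_pos
  · exact (by fun_prop : Continuous fun θ : ℝ =>
      Real.sin θ ^ k * Real.exp (r * Real.cos θ)).intervalIntegrable _ _
  · have := Real.sin_pos_of_pos_of_lt_pi hθ.1 hθ.2
    positivity

theorem hasDerivAt_poissonIntegral (k : ℕ) (r : ℝ) :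
    HasDerivAt (poissonIntegral k)
      (∫ θ in (0 : ℝ)..Real.pi, Real.cos θ * Real.sin θ ^ k * Real.exp (r * Real.cos θ)) r :=
  hasDerivAt_integral_mul_exp_mul_cos (Real.continuous_sin.pow k) r

/-- Integration by parts in Poisson's integral for the derivative. -/
theorem poissonIntegral_deriv_eq (k : ℕ) (r : ℝ) :
    (k + 1) * (∫ θ in (0 : ℝ)..Real.pi, Real.cos θ * Real.sin θ ^ k * Real.exp (r * Real.cos θ))
      = r * poissonIntegral (k + 2) r := by
  have hparts := intervalIntegral.integral_eq_sub_of_hasDerivAt (a := 0) (b := Real.pi)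
    (f := fun θ => Real.sin θ ^ (k + 1) * Real.exp (r * Real.cos θ))
    (f' := fun θ => (k + 1) * (Real.cos θ * Real.sin θ ^ k * Real.exp (r * Real.cos θ))
      - r * (Real.sin θ ^ (k + 2) * Real.exp (r * Real.cos θ)))
    (fun θ _ => by
      refine (((Real.hasDerivAt_sin θ).pow (k + 1)).mul
        ((Real.hasDerivAt_cos θ).const_mul r).exp).congr_deriv ?_
      simp only [Pi.pow_apply, Nat.add_sub_cancel]
      push_cast; ring)
    ((by fun_prop : Continuous _).intervalIntegrable _ _)
  rw [intervalIntegral.integral_sub ((by fun_prop : Continuous _).intervalIntegrable _ _)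
    ((by fun_prop : Continuous _).intervalIntegrable _ _), intervalIntegral.integral_const_mul,
    intervalIntegral.integral_const_mul] at hparts
  simp only [Real.sin_pi, Real.sin_zero, ne_eq, Nat.add_eq_zero_iff, one_ne_zero, and_false,
    not_false_eq_true, zero_pow, zero_mul, sub_zero] at hparts
  unfold poissonIntegral
  linarith

theorem isRadialPotential_poissonIntegral (k : ℕ) :
    IsRadialPotential (k + 1) (poissonIntegral k)
      (fun r => r ^ (k + 1) *
        ∫ θ in (0 : ℝ)..Real.pi, Real.cos θ * Real.sin θ ^ k * Real.exp (r * Real.cos θ))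
      (poissonIntegral k) := by
  have hcont : Continuous (poissonIntegral k) :=
    continuous_iff_continuousAt.2 fun r => (hasDerivAt_poissonIntegral k r).continuousAt
  have hder : ∀ r, HasDerivAt (fun r => ∫ θ in (0 : ℝ)..Real.pi,
      Real.cos θ * Real.sin θ ^ k * Real.exp (r * Real.cos θ))
      (poissonIntegral k r - poissonIntegral (k + 2) r) r := by
    intro r
    refine (hasDerivAt_integral_mul_exp_mul_cos
      (Real.continuous_cos.mul (Real.continuous_sin.pow k)) r).congr_deriv ?_
    unfold poissonIntegral
    rw [← intervalIntegral.integral_sub ((by fun_prop : Continuous _).intervalIntegrable _ _)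
      ((by fun_prop : Continuous _).intervalIntegrable _ _)]
    refine intervalIntegral.integral_congr fun θ _ => ?_
    simp only [pow_add, Real.sin_sq, Pi.mul_apply, Pi.pow_apply]
    ring
  refine ⟨hcont, ?_, by simp, fun r hr => ?_, fun r hr => ?_⟩
  · exact continuous_iff_continuousAt.2 fun r =>
      ((hasDerivAt_pow (k + 1) r).mul (hder r)).continuousAt
  · refine (hasDerivAt_poissonIntegral k r).congr_deriv ?_
    rw [mul_div_cancel_left₀ _ (by positivity)]
  · refine ((hasDerivAt_pow (k + 1) r).mul (hder r)).congr_deriv ?_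
    have := poissonIntegral_deriv_eq k r
    simp only [Nat.add_sub_cancel]
    push_cast
    linear_combination r ^ k * this

/-- The value at the origin, a Wallis integral. -/
theorem poissonIntegral_zero (k : ℕ) :
    poissonIntegral k 0 * Real.Gamma (k / 2 + 1) = √Real.pi * Real.Gamma ((k + 1) / 2) := by
  have h : ∀ k : ℕ, poissonIntegral k 0 = ∫ θ in (0 : ℝ)..Real.pi, Real.sin θ ^ k := fun k => by
    simp [poissonIntegral]
  rw [h]
  induction k using Nat.twoStepInduction with
  | zero =>
    simp only [pow_zero, intervalIntegral.integral_const, Nat.cast_zero, zero_div, zero_add,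
      Real.Gamma_one, Real.Gamma_one_half_eq, Real.mul_self_sqrt Real.pi_pos.le]
    simp
  | one =>
    have h1 : ((1 : ℕ) : ℝ) / 2 + 1 = 1 / 2 + 1 := by norm_num
    have h2 : (((1 : ℕ) : ℝ) + 1) / 2 = 1 := by norm_num
    rw [h1, h2, Real.Gamma_add_one (by norm_num), Real.Gamma_one_half_eq, Real.Gamma_one]
    simp [integral_sin]
    ring
  | more k ih _ =>
    have h1 : ((k + 2 : ℕ) : ℝ) / 2 + 1 = (k / 2 + 1) + 1 := by push_cast; ring
    have h2 : (((k + 2 : ℕ) : ℝ) + 1) / 2 = (k + 1) / 2 + 1 := by push_cast; ring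
    have h3 : (k : ℝ) / 2 + 1 ≠ 0 := by positivity
    have h4 : ((k : ℝ) + 1) / 2 ≠ 0 := by positivity
    rw [h1, h2, Real.Gamma_add_one h3, Real.Gamma_add_one h4, integral_sin_pow]
    simp only [Real.sin_zero, Real.sin_pi, ne_eq, Nat.add_eq_zero_iff, one_ne_zero, and_false,
      not_false_eq_true, zero_pow, zero_mul, sub_zero, zero_div, zero_add]
    have h5 : (k : ℝ) + 2 ≠ 0 := by positivity
    generalize Real.Gamma ((k : ℝ) / 2 + 1) = a at ih ⊢
    generalize Real.Gamma (((k : ℝ) + 1) / 2) = b at ih ⊢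
    field_simp
    linear_combination ih

theorem tendsto_mul_sin_div (x : ℝ) :
    Tendsto (fun ρ : ℝ => ρ * Real.sin (x / ρ)) atTop (𝓝 x) := by
  have h1 : Tendsto (fun ρ : ℝ => x * Real.sinc (x / ρ)) atTop (𝓝 (x * Real.sinc 0)) :=
    ((Real.continuous_sinc.tendsto 0).comp (tendsto_const_nhds.div_atTop tendsto_id)).const_mul x
  rw [Real.sinc_zero, mul_one] at h1
  refine h1.congr' ?_
  filter_upwards [eventually_gt_atTop 0] with ρ hρ
  rcases eq_or_ne x 0 with rfl | hx
  · simp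
  · rw [Real.sinc_of_ne_zero (by positivity)]
    field_simp

theorem integral_pow_mul_exp_neg_sq_half (k : ℕ) :
    ∫ x in Set.Ioi (0 : ℝ), x ^ k * Real.exp (-(x ^ 2 / 2))
      = 2 ^ (((k : ℝ) - 1) / 2) * Real.Gamma ((k + 1) / 2) := by
  have h := integral_rpow_mul_exp_neg_mul_rpow (p := 2) (q := k) (b := 1 / 2) two_pos
    (by linarith [show (0 : ℝ) ≤ k from Nat.cast_nonneg k]) (by norm_num)
  have h1 : ∀ x : ℝ, x ^ (k : ℝ) * Real.exp (-(1 / 2) * x ^ (2 : ℝ))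
      = x ^ k * Real.exp (-(x ^ 2 / 2)) := fun x => by
    rw [Real.rpow_natCast, Real.rpow_two]; congr 2; ring
  simp only [h1] at h
  rw [h, one_div, Real.inv_rpow two_pos.le, ← Real.rpow_neg two_pos.le]
  congr 1
  rw [← Real.rpow_neg_one, ← Real.rpow_add two_pos]
  congr 1
  ring

/-- Laplace's method: the substitution `θ = x / ρ` turns the integral into a Gaussian one. -/
theorem tendsto_poissonIntegral_sq (k : ℕ) :
    Tendsto (fun ρ : ℝ => ρ ^ (k + 1) * Real.exp (-ρ ^ 2) * poissonIntegral k (ρ ^ 2)) atTop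
      (𝓝 (2 ^ (((k : ℝ) - 1) / 2) * Real.Gamma ((k + 1) / 2))) := by
  set G : ℝ → ℝ → ℝ := fun ρ => Set.indicator (Set.Iic (ρ * Real.pi)) fun x =>
    (ρ * Real.sin (x / ρ)) ^ k * Real.exp (-(ρ ^ 2 * (1 - Real.cos (x / ρ)))) with hG
  have heq : ∀ᶠ ρ in atTop, ∫ x in Set.Ioi (0 : ℝ), G ρ x
      = ρ ^ (k + 1) * Real.exp (-ρ ^ 2) * poissonIntegral k (ρ ^ 2) := by
    filter_upwards [eventually_gt_atTop 0] with ρ hρ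
    rw [hG, setIntegral_indicator measurableSet_Iic, Set.Ioi_inter_Iic,
      ← intervalIntegral.integral_of_le (by positivity)]
    have hsub := intervalIntegral.integral_comp_div (a := 0) (b := ρ * Real.pi)
      (fun y => (ρ * Real.sin y) ^ k * Real.exp (-(ρ ^ 2 * (1 - Real.cos y)))) hρ.ne'
    rw [hsub, zero_div, mul_div_cancel_left₀ _ hρ.ne', poissonIntegral, smul_eq_mul,
      ← intervalIntegral.integral_const_mul, ← intervalIntegral.integral_const_mul]
    refine intervalIntegral.integral_congr fun θ _ => ?_
    have : Real.exp (-(ρ ^ 2 * (1 - Real.cos θ)))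
        = Real.exp (-ρ ^ 2) * Real.exp (ρ ^ 2 * Real.cos θ) := by
      rw [← Real.exp_add]; congr 1; ring
    simp only [this]
    ring
  refine Tendsto.congr' heq ?_
  rw [← integral_pow_mul_exp_neg_sq_half]
  refine tendsto_integral_filter_of_dominated_convergence
    (fun x => x ^ (k : ℝ) * Real.exp (-(2 / Real.pi ^ 2) * x ^ 2)) ?_ ?_
    (integrableOn_rpow_mul_exp_neg_mul_sq (by positivity)
      (by linarith [show (0 : ℝ) ≤ k from Nat.cast_nonneg k])) ?_
  · refine Eventually.of_forall fun ρ => ?_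
    refine Measurable.aestronglyMeasurable (Measurable.indicator ?_ measurableSet_Iic)
    fun_prop
  · filter_upwards [eventually_gt_atTop 0] with ρ hρ
    filter_upwards [ae_restrict_mem measurableSet_Ioi] with x hx
    have hx0 : 0 < x := hx
    simp only [hG, Set.indicator_apply, Set.mem_Iic]
    split_ifs with hxρ
    · have hy0 : 0 < x / ρ := by positivity
      have hyπ : x / ρ ≤ Real.pi := by rw [div_le_iff₀ hρ]; linarith
      have hsin0 := Real.sin_nonneg_of_nonneg_of_le_pi hy0.le hyπ
      have hsin1 : ρ * Real.sin (x / ρ) ≤ x := by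
        have := mul_le_mul_of_nonneg_left (Real.sin_le hy0.le) hρ.le
        rwa [mul_div_cancel₀ _ hρ.ne'] at this
      have hcos := Real.cos_le_one_sub_mul_cos_sq (x := x / ρ) (by rwa [abs_of_pos hy0])
      have hexp : -(ρ ^ 2 * (1 - Real.cos (x / ρ))) ≤ -(2 / Real.pi ^ 2) * x ^ 2 := by
        have h1 : 2 / Real.pi ^ 2 * (x / ρ) ^ 2 ≤ 1 - Real.cos (x / ρ) := by linarith
        have h2 := mul_le_mul_of_nonneg_left h1 (by positivity : 0 ≤ ρ ^ 2)
        have h3 : ρ ^ 2 * (2 / Real.pi ^ 2 * (x / ρ) ^ 2) = 2 / Real.pi ^ 2 * x ^ 2 := by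
          field_simp
        linarith
      rw [Real.norm_of_nonneg (by positivity), Real.rpow_natCast]
      gcongr
    · simp only [norm_zero]
      positivity
  · filter_upwards [ae_restrict_mem measurableSet_Ioi] with x hx
    have hx0 : 0 < x := hx
    have hhalf := (tendsto_mul_sin_div (x / 2)).pow 2
    have hcos : Tendsto (fun ρ : ℝ => ρ ^ 2 * (1 - Real.cos (x / ρ))) atTop (𝓝 (x ^ 2 / 2)) := by
      have h1 := hhalf.const_mul 2
      rw [show 2 * (x / 2) ^ 2 = x ^ 2 / 2 by ring] at h1
      refine h1.congr fun ρ => ?_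
      have h2 : x / ρ = 2 * (x / 2 / ρ) := by ring
      rw [h2, Real.cos_two_mul, mul_pow, Real.sin_sq]
      ring
    have h3 := ((tendsto_mul_sin_div x).pow k).mul (Real.continuous_exp.tendsto _ |>.comp hcos.neg)
    refine h3.congr' ?_
    filter_upwards [eventually_ge_atTop (x / Real.pi)] with ρ hρ
    rw [div_le_iff₀ Real.pi_pos] at hρ
    simp only [hG, Set.indicator_apply, Set.mem_Iic, hρ, if_true, Function.comp_apply]

theorem tendsto_poissonIntegral (k : ℕ) :
    Tendsto (fun r : ℝ => poissonIntegral k r / (r ^ (-(((k : ℝ) + 1) / 2)) * Real.exp r)) atTop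
      (𝓝 (2 ^ (((k : ℝ) - 1) / 2) * Real.Gamma ((k + 1) / 2))) := by
  refine ((tendsto_poissonIntegral_sq k).comp Real.tendsto_sqrt_atTop).congr' ?_
  filter_upwards [eventually_gt_atTop 0] with r hr
  have h1 : √r ^ (k + 1) = r ^ (((k : ℝ) + 1) / 2) := by
    rw [Real.sqrt_eq_rpow, ← Real.rpow_natCast, ← Real.rpow_mul hr.le]
    congr 1
    push_cast; ring
  simp only [Function.comp_apply, Real.sq_sqrt hr.le, h1]
  rw [Real.rpow_neg hr.le, Real.exp_neg]
  field_simp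

namespace IsRadialPotential

variable {d : ℕ} {f f₁ f₂ P P₁ P₂ h h₁ h₂ : ℝ → ℝ}

theorem add (H₁ : IsRadialPotential d f₁ P₁ h₁) (H₂ : IsRadialPotential d f₂ P₂ h₂) :
    IsRadialPotential d (f₁ + f₂) (P₁ + P₂) (h₁ + h₂) where
  continuous := H₁.continuous.add H₂.continuous
  flux_continuous := H₁.flux_continuous.add H₂.flux_continuous
  flux_zero := by simp [H₁.flux_zero, H₂.flux_zero]
  hasDerivAt r hr := ((H₁.hasDerivAt r hr).add (H₂.hasDerivAt r hr)).congr_deriv (by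
    simp [add_div])
  flux_hasDerivAt r hr := ((H₁.flux_hasDerivAt r hr).add (H₂.flux_hasDerivAt r hr)).congr_deriv (by
    simp [mul_add])

/-- Two regular radial solutions of `Δ s = s` are proportional, as their Wronskian vanishes. -/
theorem mul_eq_mul_of_eigen (H₁ : IsRadialPotential d f₁ P₁ f₁) (H₂ : IsRadialPotential d f₂ P₂ f₂)
    (hpos : ∀ r, 0 < f₂ r) {r : ℝ} (hr : 0 ≤ r) : f₁ r = f₁ 0 / f₂ 0 * f₂ r := by
  have hW : ∀ r, 0 ≤ r → P₁ r * f₂ r - f₁ r * P₂ r = 0 := by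
    intro r hr
    have hc : Continuous fun r => P₁ r * f₂ r - f₁ r * P₂ r :=
      (H₁.flux_continuous.mul H₂.continuous).sub (H₁.continuous.mul H₂.flux_continuous)
    have hder : ∀ t ∈ Set.Ioo 0 r, HasDerivAt (fun r => P₁ r * f₂ r - f₁ r * P₂ r) 0 t :=
      fun t ht => by
        refine (((H₁.flux_hasDerivAt t ht.1).mul (H₂.hasDerivAt t ht.1)).sub
          ((H₁.hasDerivAt t ht.1).mul (H₂.flux_hasDerivAt t ht.1))).congr_deriv ?_
        ring
    have h1 := sub_le_sub_of_deriv_le hr hc.continuousOn (continuousOn_const (c := (0 : ℝ))) hder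
      (fun t _ => hasDerivAt_const t 0) (fun _ _ => le_rfl)
    have h2 := sub_le_sub_of_deriv_le hr (continuousOn_const (c := (0 : ℝ))) hc.continuousOn
      (fun t _ => hasDerivAt_const t 0) hder (fun _ _ => le_rfl)
    simp only [H₁.flux_zero, H₂.flux_zero] at h1 h2
    linarith
  have hc : Continuous fun r => f₁ r / f₂ r := H₁.continuous.div H₂.continuous fun r => (hpos r).ne'
  have hder : ∀ t ∈ Set.Ioo 0 r, HasDerivAt (fun r => f₁ r / f₂ r) 0 t := fun t ht => by
    refine ((H₁.hasDerivAt t ht.1).div (H₂.hasDerivAt t ht.1) (hpos t).ne').congr_deriv ?_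
    rw [div_mul_eq_mul_div, mul_div_assoc', ← sub_div, hW t ht.1.le, zero_div, zero_div]
  have h1 := sub_le_sub_of_deriv_le hr hc.continuousOn (continuousOn_const (c := (0 : ℝ))) hder
    (fun t _ => hasDerivAt_const t 0) (fun _ _ => le_rfl)
  have h2 := sub_le_sub_of_deriv_le hr (continuousOn_const (c := (0 : ℝ))) hc.continuousOn
    (fun t _ => hasDerivAt_const t 0) hder (fun _ _ => le_rfl)
  have h3 : f₁ r / f₂ r = f₁ 0 / f₂ 0 := by linarith
  rw [← h3, div_mul_cancel₀ _ (hpos r).ne']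

/-- The energy `f' ^ 2 + f ^ 2` of a radial solution of `Δ f = -f` is nonincreasing. -/
theorem exists_abs_le_of_eq_neg (H : IsRadialPotential d f P h) (hh : ∀ r, 0 < r → h r = -f r) :
    ∃ C, ∀ r, 1 ≤ r → |f r| ≤ C := by
  refine ⟨√((P 1 / 1 ^ d) ^ 2 + f 1 ^ 2), fun r hr => Real.abs_le_sqrt ?_⟩
  have hder : ∀ t, 0 < t → HasDerivAt (fun r => (P r / r ^ d) ^ 2 + f r ^ 2)
      (-(2 * d / t * (P t / t ^ d) ^ 2)) t := fun t ht => by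
    refine ((((H.flux_hasDerivAt t ht).div (hasDerivAt_pow d t) (by positivity)).pow 2).add
      ((H.hasDerivAt t ht).pow 2)).congr_deriv ?_
    simp only [Pi.div_apply]
    rw [hh t ht]
    rcases d with _ | d
    · simp; ring
    · simp only [Nat.add_sub_cancel]
      push_cast
      field_simp
      ring
  have := sub_le_sub_of_deriv_le hr
    (fun t ht => (hder t (by linarith [ht.1])).continuousAt.continuousWithinAt)
    (continuousOn_const (c := (0 : ℝ))) (fun t ht => hder t (by linarith [ht.1]))
    (fun t _ => hasDerivAt_const t 0) (fun t ht => by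
      have : 0 < t := by linarith [ht.1]
      have : 0 ≤ 2 * d / t * (P t / t ^ d) ^ 2 := by positivity
      linarith)
  have h0 : 0 ≤ (P r / r ^ d) ^ 2 := sq_nonneg _
  linarith

end IsRadialPotential

/-- For `α = 1`, `f = ((f + g) + (f - g)) / 2`, where `f + g` is a multiple of the Poisson integral
and `f - g` is bounded. -/
theorem IsPositiveRadialSystem.tendsto_fst_div_exp {k : ℕ} {f P g Q : ℝ → ℝ}
    (H : IsPositiveRadialSystem (k + 1) 1 f P g Q) (hk : 1 ≤ k) :
    f 0 + g 0 ≠ 0 ∧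
    Tendsto (fun r : ℝ => f r / (r ^ (-(((k : ℝ) + 1) / 2)) * Real.exp r)) atTop
      (𝓝 ((f 0 + g 0) * Real.Gamma (k / 2 + 1) * 2 ^ (((k : ℝ) - 3) / 2)
        * Real.pi ^ (-(1 / 2) : ℝ))) := by
  have hg : IsRadialPotential (k + 1) g Q f := by
    simpa only [Real.rpow_one] using H.snd
  have hsum : IsRadialPotential (k + 1) (f + g) (P + Q) (f + g) := by
    have := H.fst.add hg
    rwa [add_comm g f] at this
  obtain ⟨C, hC⟩ := (H.fst.add hg.neg).exists_abs_le_of_eq_neg fun r _ => by simp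
  have hF := isRadialPotential_poissonIntegral k
  have hprop : ∀ r, 0 ≤ r → f r + g r
      = (f 0 + g 0) / poissonIntegral k 0 * poissonIntegral k r := fun r hr =>
    hsum.mul_eq_mul_of_eigen hF (poissonIntegral_pos k) hr
  have hdecomp : ∀ r, 0 ≤ r → f r = 1 / 2 * ((f 0 + g 0) / poissonIntegral k 0
      * poissonIntegral k r) + 1 / 2 * (f r - g r) := fun r hr => by
    rw [← hprop r hr]; ring
  constructor
  · intro h0
    obtain ⟨r, hr, hr1⟩ := (((H.tendsto_fst (by omega) le_rfl).eventually_gt_atTop C).and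
      (eventually_ge_atTop 1)).exists
    have h1 := hdecomp r (by linarith)
    rw [h0, zero_div, zero_mul, mul_zero, zero_add] at h1
    have h2 := (le_abs_self _).trans (hC r hr1)
    simp only [Pi.add_apply, Pi.neg_apply] at h2
    have h3 := H.pos r
    linarith
  set E : ℝ → ℝ := fun r => r ^ (-(((k : ℝ) + 1) / 2)) * Real.exp r with hE
  have hEtop : Tendsto E atTop atTop := by
    refine (tendsto_exp_div_rpow_atTop (((k : ℝ) + 1) / 2)).congr' ?_
    filter_upwards [eventually_gt_atTop 0] with r hr
    simp only [hE, Real.rpow_neg hr.le, div_eq_inv_mul]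
  have hD : Tendsto (fun r => (f r - g r) / E r) atTop (𝓝 0) := by
    refine squeeze_zero_norm' ?_
      (tendsto_const_nhds.div_atTop hEtop : Tendsto (fun r => C / E r) atTop (𝓝 0))
    filter_upwards [eventually_ge_atTop 1, hEtop.eventually_gt_atTop 0] with r hr hE0
    rw [norm_div, Real.norm_of_nonneg hE0.le, Real.norm_eq_abs]
    have := hC r hr
    simp only [Pi.add_apply, Pi.neg_apply, ← sub_eq_add_neg] at this
    gcongr
  have hlim := ((tendsto_poissonIntegral k).const_mul
    (1 / 2 * ((f 0 + g 0) / poissonIntegral k 0))).add (hD.const_mul (1 / 2))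
  have hval : 1 / 2 * ((f 0 + g 0) / poissonIntegral k 0)
      * (2 ^ (((k : ℝ) - 1) / 2) * Real.Gamma ((k + 1) / 2)) + 1 / 2 * 0
      = (f 0 + g 0) * Real.Gamma (k / 2 + 1) * 2 ^ (((k : ℝ) - 3) / 2)
        * Real.pi ^ (-(1 / 2) : ℝ) := by
    have h1 : (2 : ℝ) ^ (((k : ℝ) - 1) / 2) = 2 * 2 ^ (((k : ℝ) - 3) / 2) := by
      rw [show ((k : ℝ) - 1) / 2 = 1 + (k - 3) / 2 by ring, Real.rpow_add two_pos, Real.rpow_one]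
    have h2 : Real.pi ^ (-(1 / 2) : ℝ) = (√Real.pi)⁻¹ := by
      rw [Real.rpow_neg Real.pi_pos.le, Real.sqrt_eq_rpow]
    have h3 := poissonIntegral_zero k
    have h4 := (poissonIntegral_pos k 0).ne'
    have h5 : √Real.pi ≠ 0 := (Real.sqrt_pos.2 Real.pi_pos).ne'
    rw [h1, h2]
    generalize Real.Gamma ((k : ℝ) / 2 + 1) = a at h3 ⊢
    generalize Real.Gamma (((k : ℝ) + 1) / 2) = b at h3 ⊢
    generalize (2 : ℝ) ^ (((k : ℝ) - 3) / 2) = c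
    field_simp
    linear_combination -2 * (f 0 + g 0) * c * h3
  rw [hval] at hlim
  refine hlim.congr' ?_
  filter_upwards [eventually_ge_atTop 0, hEtop.eventually_gt_atTop 0] with r hr hE0
  have h1 := hdecomp r hr
  have h2 : f r / E r = (1 / 2 * ((f 0 + g 0) / poissonIntegral k 0
      * poissonIntegral k r) + 1 / 2 * (f r - g r)) / E r := by rw [← h1]
  rw [h2]
  simp only [hE]
  ring

/-! ### The four asymptotic regimes -/

theorem AsympAtInfty.of_tendsto_div {u f b c : ℝ → ℝ} {C : ℝ} (hC : C ≠ 0)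
    (h : Tendsto (fun r => f r / b r) atTop (𝓝 C)) (huf : ∀ᶠ r in atTop, u r = f r)
    (hc : ∀ᶠ r in atTop, c r = C * b r) : AsympAtInfty u c := by
  have h1 := h.div_const C
  rw [div_self hC] at h1
  refine h1.congr' ?_
  filter_upwards [huf, hc] with r hr hr'
  rw [hr, hr', div_div, mul_comm]

theorem theorem1 (n : ℕ) (hn : 3 ≤ n) (α : ℝ)
    (U : EuclideanSpace ℝ (Fin n) → ℝ) (u : ℝ → ℝ)
    (hU : IsPositiveEntireSolution n α U) (hu : IsRadialWithProfile U u) :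
    (α = 1 →
      AsympAtInfty u (fun r =>
        (u 0 + (n : ℝ) * iteratedDerivWithin 2 u (Set.Ici 0) 0) * Real.Gamma ((n : ℝ) / 2)
          * (2 : ℝ) ^ (((n : ℝ) - 5) / 2) * Real.pi ^ (-(1 / 2) : ℝ)
          * r ^ (-(((n : ℝ) - 1) / 2)) * Real.exp r)) ∧
    (-1 < α → α < 1 →
      AsympAtInfty u (fun r =>
        (((n : ℝ) + 4 * α / (1 - α)) * ((n : ℝ) + 4 * α / (1 - α) + 2)
            * (4 * α / (1 - α) + 2) * (4 * α / (1 - α) + 4)) ^ (-(1 / (1 - α)))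
          * r ^ (4 / (1 - α)))) ∧
    (α = -1 →
      AsympAtInfty u (fun r =>
        ((n : ℝ) * ((n : ℝ) - 2)) ^ (-(1 / 2) : ℝ) * r ^ 2 * Real.log r ^ (1 / 2 : ℝ))) ∧
    (α < -1 →
      IntegrableOn (fun t : ℝ => t * u t ^ α) (Set.Ioi 0) ∧
      AsympAtInfty u (fun r =>
        1 / (2 * (n : ℝ))
          * (Δ U 0 + 1 / ((n : ℝ) - 2) * ∫ t in Set.Ioi (0 : ℝ), t * u t ^ α) * r ^ 2)) := by
  obtain ⟨k, rfl⟩ : ∃ k, n = k + 1 + 1 := ⟨n - 2, by omega⟩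
  have hk : 1 ≤ k := by omega
  have hk0 : (0 : ℝ) < k := by exact_mod_cast hk
  have hncast : ((k + 1 + 1 : ℕ) : ℝ) = k + 2 := by push_cast; ring
  obtain ⟨hC4, hpos, heq⟩ := hU
  have hrad : ∀ x y, ‖x‖ = ‖y‖ → U x = U y := fun x y hxy => by rw [hu, hu, hxy]
  have hC2 : ContDiff ℝ 2 U := hC4.of_le (by norm_num)
  have hV2 : ContDiff ℝ 2 (Δ U) := ContDiff.laplacian_euclidean (k := 2) (by
    refine hC4.of_le (le_of_eq ?_)
    norm_num)
  have hVrad : ∀ x y, ‖x‖ = ‖y‖ → Δ U x = Δ U y := fun x y => laplacian_eq_of_norm_eq hC2 hrad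
  set f : ℝ → ℝ := fun r => U (r • EuclideanSpace.single 0 1) with hf
  set g : ℝ → ℝ := fun r => Δ U (r • EuclideanSpace.single 0 1) with hg
  have hfu : ∀ r, 0 ≤ r → u r = f r := fun r hr => by
    rw [show f r = u ‖r • EuclideanSpace.single (0 : Fin (k + 1 + 1)) (1 : ℝ)‖ from hu _]
    simp [norm_smul, abs_of_nonneg hr]
  have hfu' : ∀ᶠ r in atTop, u r = f r := by
    filter_upwards [eventually_ge_atTop 0] with r hr using hfu r hr
  have hg0 : g 0 = Δ U 0 := by simp [hg]
  have hfst := isRadialPotential_profile k.succ_ne_zero hC2 hrad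
  have hsnd := isRadialPotential_profile k.succ_ne_zero hV2 hVrad
  simp only [heq] at hsnd
  obtain ⟨P, Q, H⟩ : ∃ P Q, IsPositiveRadialSystem (k + 1) α f P g Q :=
    ⟨_, _, hfst, hsnd, fun r => hpos _⟩
  refine ⟨?_, ?_, ?_, ?_⟩
  · rintro rfl
    obtain ⟨hne, hlim⟩ := H.tendsto_fst_div_exp hk
    have hderiv : iteratedDerivWithin 2 u (Set.Ici 0) 0 = deriv (deriv f) 0 := by
      rw [iteratedDerivWithin_congr (g := f) (s := Set.Ici 0) (fun r hr => hfu r hr)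
          Set.self_mem_Ici,
        iteratedDerivWithin_eq_iteratedDeriv (uniqueDiffOn_Ici 0)
          (contDiff_profile hC2).contDiffAt Set.self_mem_Ici, iteratedDeriv_succ, iteratedDeriv_one]
    have hcoef : u 0 + ((k + 1 + 1 : ℕ) : ℝ) * iteratedDerivWithin 2 u (Set.Ici 0) 0
        = f 0 + g 0 := by
      rw [hderiv, hfu 0 le_rfl, hg0, laplacian_radial_zero hC2 hrad]
      push_cast
      rfl
    rw [hcoef]
    refine AsympAtInfty.of_tendsto_div ?_ hlim hfu' (Eventually.of_forall fun r => ?_)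
    · have : 0 < Real.Gamma ((k : ℝ) / 2 + 1) := Real.Gamma_pos_of_pos (by positivity)
      have := Real.pi_pos
      exact mul_ne_zero (mul_ne_zero (mul_ne_zero hne (by positivity)) (by positivity))
        (by positivity)
    · rw [hncast, show ((k : ℝ) + 2) / 2 = k / 2 + 1 by ring,
        show ((k : ℝ) + 2 - 5) / 2 = (k - 3) / 2 by ring,
        show ((k : ℝ) + 2 - 1) / 2 = (k + 1) / 2 by ring]
      ring
  · intro h1 h2
    have h1α : 1 - α ≠ 0 := by linarith
    have hp2 := IsPositiveRadialSystem.two_lt_exponent h1 h2 rfl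
    have hA := IsPositiveRadialSystem.bilaplacianCoeff_pos (d := k + 1) (by omega) hp2
    have hcoef : (((k + 1 + 1 : ℕ) : ℝ) + 4 * α / (1 - α))
        * (((k + 1 + 1 : ℕ) : ℝ) + 4 * α / (1 - α) + 2) * (4 * α / (1 - α) + 2)
        * (4 * α / (1 - α) + 4) = IsPositiveRadialSystem.bilaplacianCoeff (k + 1) (4 / (1 - α)) := by
      rw [IsPositiveRadialSystem.bilaplacianCoeff]
      have : 4 * α / (1 - α) = 4 / (1 - α) - 4 := by field_simp; ring
      rw [this]
      push_cast
      ring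
    rw [hcoef]
    exact AsympAtInfty.of_tendsto_div (by positivity)
      (H.tendsto_fst_div_rpow (by omega) h1 h2 rfl) hfu' (Eventually.of_forall fun r => rfl)
  · rintro rfl
    refine AsympAtInfty.of_tendsto_div (by positivity) (H.tendsto_fst_div_sq_mul_sqrt_log hk) hfu'
      (Eventually.of_forall fun r => ?_)
    have h1 : ((k + 1 + 1 : ℕ) : ℝ) * (((k + 1 + 1 : ℕ) : ℝ) - 2)
        = (((k + 1 : ℕ) : ℝ) + 1) * k := by push_cast; ring
    rw [h1, Real.rpow_neg (by positivity), ← Real.sqrt_eq_rpow, ← Real.sqrt_eq_rpow]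
    ring
  · intro hα
    have hint := H.integrableOn_mul_source (by omega) hα
    have hcongr : Set.EqOn (fun t => t * f t ^ α) (fun t => t * u t ^ α) (Set.Ioi 0) :=
      fun t ht => by
        have ht0 : 0 < t := ht
        simp only [hfu t ht0.le]
    refine ⟨hint.congr_fun hcongr measurableSet_Ioi, ?_⟩
    rw [← setIntegral_congr_fun measurableSet_Ioi hcongr, ← hg0]
    have hlim := H.tendsto_snd hk hint
    obtain ⟨c, hc, hge⟩ := H.exists_forall_le_snd (by omega) (by linarith)
    have hV := hc.trans_le (ge_of_tendsto hlim hge)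
    refine AsympAtInfty.of_tendsto_div (by positivity) (H.fst.tendsto_div_sq hlim) hfu'
      (Eventually.of_forall fun r => ?_)
    rw [hncast]
    push_cast
    rw [show (k : ℝ) + 2 - 2 = k by ring, show (k : ℝ) + 1 + 1 = k + 2 by ring]
    ring
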